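/- Let $n\ge 1$ be an integer, $\mu>0$ and $p>1$. For real $d>0$ put $p_\infty(d)=1+\frac2d$, and for real $d>1$ let $p_0(d)$ be the positive root of $(d-1)p^2-(d+1)p-2=0$. Let $v_0\in C^2_c(\mathbb R^n)$ and $v_1\in C^1_c(\mathbb R^n)$ be real-valued with $v_0\ge 0$, $v_1\ge 0$ and $(v_0,v_1)\not\equiv(0,0)$. Let $0<T\le\infty$ and let $v\in C^2([0,T)\times\mathbb R^n)$ be a real-valued classical solution of $$v_{tt}-\Delta v+\frac{\mu}{1+t}\,v_t+\frac{m}{4(1+t)^2}\,v=|v|^p,\qquad v(0,x)=v_0(x),\quad v_t(0,x)=v_1(x),$$ on $[0,T)\times\mathbb R^n$, with $m=(\mu-2)\mu$. If $$1<p\le \max\Big\{p_\infty\big(n-1+\tfrac{\mu}{2}\big),\ p_0(n+\mu)\Big\},$$ then $T<\infty$; that is, there is no $C^2$ solution that is global in time. -/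

import Mathlib

open Set

noncomputable section

/-- The Fujita-type exponent `p_∞(d) = 1 + 2 / d`, for a real "dimension" `d > 0`. -/
def pFujita (d : ℝ) : ℝ := 1 + 2 / d

/-- The Strauss exponent `p_0(d)`: the positive root `p` of `(d - 1) p ^ 2 - (d + 1) p - 2 = 0`,
for a real "dimension" `d > 1` (see `eq_pStrauss_iff`). -/
def pStrauss (d : ℝ) : ℝ :=
  ((d + 1) + √((d + 1) ^ 2 + 8 * (d - 1))) / (2 * (d - 1))

/-- For `d > 1`, `pStrauss d` is the unique positive root of the defining quadratic equation. -/
theorem eq_pStrauss_iff {d : ℝ} (hd : 1 < d) (p : ℝ) :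
    p = pStrauss d ↔ 0 < p ∧ (d - 1) * p ^ 2 - (d + 1) * p - 2 = 0 := by
  have h1 : 0 < d - 1 := by linarith
  set s : ℝ := √((d + 1) ^ 2 + 8 * (d - 1)) with hs
  have hs2 : s ^ 2 = (d + 1) ^ 2 + 8 * (d - 1) := Real.sq_sqrt (by positivity)
  have hs0 : 0 ≤ s := Real.sqrt_nonneg _
  have hsd : d + 1 < s := by nlinarith
  have hp : pStrauss d * (2 * (d - 1)) = (d + 1) + s := by
    unfold pStrauss
    rw [← hs]
    field_simp
  constructor
  · rintro rfl
    have hpos : 0 < pStrauss d := by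
      by_contra h
      nlinarith
    refine ⟨hpos, ?_⟩
    have h3 : 4 * (d - 1) *
        ((d - 1) * pStrauss d ^ 2 - (d + 1) * pStrauss d - 2) = 0 := by
      have : (pStrauss d * (2 * (d - 1)) - (d + 1)) ^ 2 = s ^ 2 := by rw [hp]; ring
      nlinarith
    rcases mul_eq_zero.1 h3 with h | h
    · linarith
    · exact h
  · rintro ⟨hpos, h⟩
    have h4 : (p * (2 * (d - 1)) - (d + 1) - s) * (p * (2 * (d - 1)) - (d + 1) + s) = 0 := by
      nlinarith
    rcases mul_eq_zero.1 h4 with h5 | h5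
    · have h6 : (p - pStrauss d) * (2 * (d - 1)) = 0 := by nlinarith
      rcases mul_eq_zero.1 h6 with h7 | h7 <;> linarith
    · nlinarith [mul_pos hpos h1]

/-- The time interval `[0, T)`, where `T = ∞` is allowed. -/
def timeInterval (T : EReal) : Set ℝ := {t : ℝ | 0 ≤ t ∧ (t : EReal) < T}

/-- `v ∈ C²([0, T) × ℝⁿ)` is a classical solution of the Cauchy problem
`v_tt - Δ v + μ / (1 + t) v_t + m / (4 (1 + t) ^ 2) v = |v| ^ p`, `v(0, x) = v₀ x`,
`v_t(0, x) = v₁ x`. Time derivatives are taken within `[0, T)`, so they are one-sided at `t = 0`;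
`C²` regularity is up to and including `t = 0`. -/
structure IsClassicalSolution (n : ℕ) (μ m p : ℝ) (v₀ v₁ : EuclideanSpace ℝ (Fin n) → ℝ)
    (T : EReal) (v : ℝ → EuclideanSpace ℝ (Fin n) → ℝ) : Prop where
  contDiffOn : ContDiffOn ℝ 2 (fun z : ℝ × EuclideanSpace ℝ (Fin n) => v z.1 z.2)
    (timeInterval T ×ˢ univ)
  equation : ∀ t ∈ timeInterval T, ∀ x : EuclideanSpace ℝ (Fin n),
    iteratedDerivWithin 2 (fun s => v s x) (timeInterval T) t - Laplacian.laplacian (v t) x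
      + μ / (1 + t) * derivWithin (fun s => v s x) (timeInterval T) t
      + m / (4 * (1 + t) ^ 2) * v t x = |v t x| ^ p
  initial_value : ∀ x, v 0 x = v₀ x
  initial_velocity : ∀ x, derivWithin (fun s => v s x) (timeInterval T) 0 = v₁ x

end

/-!
# Blow-up for the scale-invariant damped wave equation with a balanced mass

Since the mass is `m = μ (μ - 2)`, the substitution `u = (1 + t) ^ (μ / 2) v` removes the damping and
the mass together and leaves `u_tt - Δu = (1 + t) ^ (-κ) |u| ^ p` with `κ = μ (p - 1) / 2`, with
`u(0) = v₀ ≥ 0` and `u_t(0) = v₁ + (μ / 2) v₀ ≥ 0`, the latter not identically zero. A weighted energy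
estimate on backward light cones (`eq_zero_of_data_eq_zero`) confines `u` to `‖x‖ ≤ t + R₀`, so all
spatial integrals below are over compact sets.

If `H` solves the free wave equation on this cone and vanishes at time `t`, then
`-∫ u(t) ∂ₜH(t) dx` is the contribution of the data plus `∫₀ᵗ ∫ (1 + s) ^ (-κ) |u| ^ p H dx ds`
(`duality_identity`). Bounding the left side by Hölder's inequality turns each choice of `H` into an
inequality for the source `J(s) = ∫ (1 + s) ^ (-κ) |u| ^ p dx` (`rpow_le_sourceMass_mul`).

* `H = t - s` gives the inequality for the mean of `u`; it settles `p ≤ p_∞(n - 1 + μ / 2)`.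
* Outside that range the Strauss condition forces `n ≥ 2`, and `H` is built from the conformal
  solutions `((t + τ)² - ‖x‖²) ^ (-(n - 1) / 2)`. Their odd reflections across time `t` (`reflectedKernel`) are positive before time
  `t`. A single one shows that the source does not decay too fast (`exists_le_sourceMass`). The dyadic
  superposition over `τ ∼ 2 ^ j` with weights `2 ^ (j γ)` (`dyadicKernel`) has a time derivative of size
  `t ^ (-(n - 1) / 2) D ^ (-1 / p')`, where `D` is the distance to the boundary of the cone and
  `1 / p + 1 / p' = 1`. Its `L^p'` norm diverges only logarithmically, which is exactly what the
  critical exponent tolerates (`exists_integral_inequality`).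

In both ranges a function `i ≥ c > 0` (a power of `t` times `J`) satisfies
`(∫ (1 - s / t) i(s) ds / s) ^ p ≤ C i(t) (log t) ^ (p - 1)` for all large `t`. This is impossible
(`not_integral_inequality`): lower bounds `i ≥ A log t` improve themselves, with constants tending
to infinity, while the half lines on which they hold shrink only to a half line. Only inequalities
between exponents enter, so the critical and subcritical cases are treated together.
-/

open MeasureTheory Filter Topology

/-! ### Integrals of compactly supported functions of space and time -/

theorem integral_fderiv_apply_eq_zero {E : Type*} [NormedAddCommGroup E] [NormedSpace ℝ E]
    [FiniteDimensional ℝ E] [MeasurableSpace E] [BorelSpace E] (μ : Measure E)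
    [μ.IsAddHaarMeasure] {F : E → ℝ} (hF : ContDiff ℝ 1 F) (hc : HasCompactSupport F) (w : E) :
    ∫ x, fderiv ℝ F x w ∂μ = 0 := by
  have hcont : Continuous fun x => fderiv ℝ F x w :=
    (hF.continuous_fderiv one_ne_zero).clm_apply continuous_const
  have hint : Integrable (fun x => fderiv ℝ F x w) μ :=
    hcont.integrable_of_hasCompactSupport (hc.fderiv_apply ℝ w)
  have := integral_mul_fderiv_eq_neg_fderiv_mul_of_integrable (𝕜 := ℝ) (μ := μ)
    (f := fun _ : E => (1 : ℝ)) (g := F) (v := w) (by simp) (by simpa using hint)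
    (by simpa using hF.continuous.integrable_of_hasCompactSupport hc)
    (fun x _ => differentiableAt_const _)
    (fun x _ => (hF.differentiable one_ne_zero) x)
  simpa using this

theorem hasCompactSupport_of_forall_lt_dist {E : Type*} [NormedAddCommGroup E]
    [ProperSpace E] {f : E → ℝ} {c : E} {ρ : ℝ} (h : ∀ x, ρ < dist x c → f x = 0) :
    HasCompactSupport f :=
  HasCompactSupport.intro (isCompact_closedBall c ρ) fun x hx => h x (by simpa using hx)

section Slices

theorem isOpen_Ioi_prod_univ {E : Type*} [NormedAddCommGroup E] : IsOpen (Ioi (0 : ℝ) ×ˢ (univ : Set E)) :=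
  isOpen_Ioi.prod isOpen_univ

theorem continuous_slice {E : Type*} [NormedAddCommGroup E] {F : ℝ × E → ℝ}
    (hF : ContinuousOn F (Ioi (0 : ℝ) ×ˢ univ)) {s : ℝ} (hs : 0 < s) :
    Continuous fun x => F (s, x) := by
  rw [← continuousOn_univ]
  exact hF.comp (by fun_prop) fun x _ => ⟨hs, mem_univ _⟩

variable {E : Type*} [NormedAddCommGroup E] [NormedSpace ℝ E]

theorem fderiv_apply_contDiffOn {F : ℝ × E → ℝ} {m : WithTop ℕ∞} {m' : WithTop ℕ∞}
    (hF : ContDiffOn ℝ m F (Ioi (0 : ℝ) ×ˢ univ)) (hm : m' + 1 ≤ m) (w : ℝ × E) :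
    ContDiffOn ℝ m' (fun z => fderiv ℝ F z w) (Ioi (0 : ℝ) ×ˢ univ) :=
  (hF.fderiv_of_isOpen isOpen_Ioi_prod_univ hm).clm_apply contDiffOn_const

theorem contDiffOn_differentiableAt {F : ℝ × E → ℝ}
    (hF : ContDiffOn ℝ 1 F (Ioi (0 : ℝ) ×ˢ univ)) {z : ℝ × E} (hz : 0 < z.1) :
    DifferentiableAt ℝ F z :=
  (hF.contDiffAt (isOpen_Ioi_prod_univ.mem_nhds ⟨hz, mem_univ _⟩)).differentiableAt one_ne_zero

theorem contDiff_slice {F : ℝ × E → ℝ} {m : WithTop ℕ∞}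
    (hF : ContDiffOn ℝ m F (Ioi (0 : ℝ) ×ˢ univ)) {s : ℝ} (hs : 0 < s) :
    ContDiff ℝ m fun x => F (s, x) := by
  rw [← contDiffOn_univ]
  exact hF.comp (contDiff_prodMk_right s).contDiffOn fun x _ => ⟨hs, mem_univ _⟩

theorem fderiv_slice_space {F : ℝ × E → ℝ} {s : ℝ} {x : E} (hF : DifferentiableAt ℝ F (s, x))
    (w : E) : fderiv ℝ (fun y => F (s, y)) x w = fderiv ℝ F (s, x) (0, w) := by
  have h := hF.hasFDerivAt.comp x (hasFDerivAt_prodMk_right s x)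
  have h' : HasFDerivAt (fun y => F (s, y)) _ x := h
  rw [h'.fderiv]
  simp

theorem hasDerivAt_slice_time {F : ℝ × E → ℝ} {s : ℝ} {x : E}
    (hF : DifferentiableAt ℝ F (s, x)) :
    HasDerivAt (fun r => F (r, x)) (fderiv ℝ F (s, x) (1, 0)) s := by
  have h := hF.hasFDerivAt.comp_hasDerivAt s
    ((hasDerivAt_id s).prodMk (hasDerivAt_const s x))
  exact h

theorem fderiv_eq_zero_of_lt_dist {F : ℝ × E → ℝ} {a b s : ℝ} {c x : E} {ρ : ℝ}
    (h0 : ∀ r ∈ Ioo a b, ∀ x, ρ < dist x c → F (r, x) = 0) (hs : s ∈ Ioo a b)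
    (hx : ρ < dist x c) : fderiv ℝ F (s, x) = 0 := by
  have hop : IsOpen (Ioo a b ×ˢ {x : E | ρ < dist x c}) :=
    isOpen_Ioo.prod (isOpen_lt continuous_const (by fun_prop))
  have hev : F =ᶠ[𝓝 (s, x)] fun _ => 0 := by
    filter_upwards [hop.mem_nhds ⟨hs, hx⟩] with z hz
    exact h0 z.1 hz.1 z.2 hz.2
  rw [hev.fderiv_eq]
  simp

variable [FiniteDimensional ℝ E] [MeasurableSpace E] [BorelSpace E]

theorem integrable_slice (μ : Measure E) [μ.IsAddHaarMeasure] {F : ℝ × E → ℝ}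
    (hF : ContinuousOn F (Ioi (0 : ℝ) ×ˢ univ)) {s : ℝ} (hs : 0 < s) {c : E} {ρ : ℝ}
    (h0 : ∀ x, ρ < dist x c → F (s, x) = 0) : Integrable (fun x => F (s, x)) μ :=
  (continuous_slice hF hs).integrable_of_hasCompactSupport
    (hasCompactSupport_of_forall_lt_dist h0)

/-- The divergence theorem on a time slice: spatial derivatives of compactly supported functions
have vanishing integral. -/
theorem integral_fderiv_space_eq_zero (μ : Measure E) [μ.IsAddHaarMeasure] {F : ℝ × E → ℝ}
    (hF : ContDiffOn ℝ 1 F (Ioi (0 : ℝ) ×ˢ univ)) {s : ℝ} (hs : 0 < s) {c : E} {ρ : ℝ}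
    (h0 : ∀ x, ρ < dist x c → F (s, x) = 0) (w : E) :
    ∫ x, fderiv ℝ F (s, x) (0, w) ∂μ = 0 := by
  refine (integral_congr_ae (Eventually.of_forall fun x => ?_)).trans
    (integral_fderiv_apply_eq_zero μ (contDiff_slice hF hs)
      (hasCompactSupport_of_forall_lt_dist h0) w)
  exact (fderiv_slice_space (contDiffOn_differentiableAt hF hs) w).symm

/-- Differentiation under the integral sign for functions with locally uniformly compact
support in space. -/
theorem hasDerivAt_integral_slice (μ : Measure E) [μ.IsAddHaarMeasure] {F : ℝ × E → ℝ}
    (hF : ContDiffOn ℝ 1 F (Ioi (0 : ℝ) ×ˢ univ)) {a b s : ℝ} (ha : 0 ≤ a) (hs : s ∈ Ioo a b)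
    {c : E} {ρ : ℝ} (h0 : ∀ r ∈ Ioo a b, ∀ x, ρ < dist x c → F (r, x) = 0) :
    HasDerivAt (fun r => ∫ x, F (r, x) ∂μ) (∫ x, fderiv ℝ F (s, x) (1, 0) ∂μ) s := by
  obtain ⟨ε, hε, hsub⟩ := Metric.nhds_basis_closedBall.mem_iff.1 (Ioo_mem_nhds hs.1 hs.2)
  have hder : ∀ r ∈ Ioo a b, ∀ x, HasDerivAt (fun r => F (r, x)) (fderiv ℝ F (r, x) (1, 0)) r :=
    fun r hr x => hasDerivAt_slice_time (contDiffOn_differentiableAt hF (ha.trans_lt hr.1))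
  have hc' : ContinuousOn (fun z => fderiv ℝ F z (1, 0)) (Ioi (0 : ℝ) ×ˢ (univ : Set E)) :=
    (fderiv_apply_contDiffOn (m' := 0) hF (by simp) _).continuousOn
  have h0' : ∀ r ∈ Ioo a b, ∀ x, ρ < dist x c → fderiv ℝ F (r, x) (1, 0) = 0 := by
    intro r hr x hx
    rw [fderiv_eq_zero_of_lt_dist h0 hr hx]
    simp
  have hK : IsCompact (Metric.closedBall s ε ×ˢ Metric.closedBall c ρ) :=
    (isCompact_closedBall s ε).prod (isCompact_closedBall c ρ)
  obtain ⟨C, hC⟩ := hK.exists_bound_of_continuousOn (hc'.mono fun z hz =>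
    ⟨ha.trans_lt (hsub hz.1).1, mem_univ _⟩)
  have hspos : 0 < s := ha.trans_lt hs.1
  refine (hasDerivAt_integral_of_dominated_loc_of_deriv_le (μ := μ)
    (F := fun r x => F (r, x)) (F' := fun r x => fderiv ℝ F (r, x) (1, 0))
    (bound := (Metric.closedBall c ρ).indicator fun _ => C) (Metric.closedBall_mem_nhds s hε)
    ?_ ?_ ?_ ?_ ?_ ?_).2
  · filter_upwards [Ioo_mem_nhds hs.1 hs.2] with r hr
    exact (continuous_slice hF.continuousOn (ha.trans_lt hr.1)).aestronglyMeasurable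
  · exact integrable_slice μ hF.continuousOn hspos (h0 s hs)
  · exact (continuous_slice hc' hspos).aestronglyMeasurable
  · refine Eventually.of_forall fun x r hr => ?_
    by_cases hx : x ∈ Metric.closedBall c ρ
    · rw [indicator_of_mem hx]
      exact hC (r, x) ⟨hr, hx⟩
    · rw [indicator_of_notMem hx, h0' r (hsub hr) x (by simpa using hx), norm_zero]
  · exact (integrable_indicator_iff measurableSet_closedBall).2
      (integrableOn_const (measure_closedBall_lt_top.ne))
  · exact Eventually.of_forall fun x r hr => hder r (hsub hr) x

end Slices

/-! ### An integral inequality without global solutions -/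

/-- Lower bound of the weighted integral by the contribution of a subinterval. -/
theorem le_integral_weight {i : ℝ → ℝ} {t₀ t b d m : ℝ} (ht₀ : 0 < t₀)
    (hi : ContinuousOn i (Ici t₀)) (hpos : ∀ s, t₀ ≤ s → 0 ≤ i s) (hb : t₀ ≤ b) (hbd : b ≤ d)
    (hd : d ≤ t) (hm : ∀ s ∈ Icc b d, m ≤ i s) (hm0 : 0 ≤ m) :
    (1 - d / t) * m * Real.log (d / b) ≤ ∫ s in t₀..t, (1 - s / t) * i s / s := by
  have hb0 : 0 < b := ht₀.trans_le hb
  have hd0 : 0 < d := hb0.trans_le hbd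
  have ht : 0 < t := hd0.trans_le hd
  have hcont : ContinuousOn (fun s => (1 - s / t) * i s / s) (Ici t₀) := by
    refine ContinuousOn.div (ContinuousOn.mul (by fun_prop) hi) (by fun_prop) ?_
    intro s hs
    exact (ht₀.trans_le hs).ne'
  have hint : ∀ x y, t₀ ≤ x → x ≤ y →
      IntervalIntegrable (fun s => (1 - s / t) * i s / s) volume x y := by
    intro x y hx hy
    refine ContinuousOn.intervalIntegrable (hcont.mono ?_)
    rw [uIcc_of_le hy]
    exact fun s hs => hx.trans hs.1
  have hnn : ∀ x y, t₀ ≤ x → x ≤ y → y ≤ t → 0 ≤ ∫ s in x..y, (1 - s / t) * i s / s := by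
    intro x y hx hy hyt
    refine intervalIntegral.integral_nonneg hy fun s hs => ?_
    have h1 : t₀ ≤ s := hx.trans hs.1
    have h2 : s / t ≤ 1 := (div_le_one ht).2 (hs.2.trans hyt)
    exact div_nonneg (mul_nonneg (by linarith) (hpos s h1)) (ht₀.le.trans h1)
  rw [← intervalIntegral.integral_add_adjacent_intervals (hint t₀ b le_rfl hb)
    (hint b t hb (hbd.trans hd)), ← intervalIntegral.integral_add_adjacent_intervals
    (hint b d hb hbd) (hint d t (hb.trans hbd) hd)]
  have h1 := hnn t₀ b le_rfl hb (hbd.trans hd)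
  have h2 := hnn d t (hb.trans hbd) hd le_rfl
  have h3 : (1 - d / t) * m * Real.log (d / b) ≤ ∫ s in b..d, (1 - s / t) * i s / s := by
    rw [← integral_one_div_of_pos hb0 hd0, ← intervalIntegral.integral_const_mul]
    refine intervalIntegral.integral_mono_on hbd ?_ (hint b d hb hbd) ?_
    · refine ContinuousOn.intervalIntegrable ?_
      rw [uIcc_of_le hbd]
      refine ContinuousOn.mul (by fun_prop) (ContinuousOn.div (by fun_prop) (by fun_prop) ?_)
      intro s hs
      exact (hb0.trans_le hs.1).ne'
    · intro s hs
      have hs0 : 0 < s := hb0.trans_le hs.1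
      rw [mul_one_div]
      gcongr
      · have : d / t ≤ 1 := (div_le_one ht).2 hd
        have : s / t ≤ d / t := by gcongr; exact hs.2
        linarith
      · exact hs.2
      · exact hm s hs
  linarith

/-- In logarithmic time the hypothesis reads
`(∫ (1 - e ^ (σ - τ)) i dσ) ^ p ≤ C i(τ) τ ^ (p - 1)`. The bound `i ≥ A log` on a half line improves
to `i ≥ A ^ p (c δ) ^ (2 p) log` at the cost of a shift `δ` in logarithmic time; shifts
`δ = 2 ^ (-j)` are summable while the constants tend to infinity. -/
theorem not_integral_inequality {i : ℝ → ℝ} {t₀ c C p : ℝ} (ht₀ : 1 ≤ t₀) (hp : 1 < p)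
    (hc : 0 < c) (hi : ContinuousOn i (Ici t₀)) (hci : ∀ t, t₀ ≤ t → c ≤ i t)
    (h : ∀ t, t₀ ≤ t →
      (∫ s in t₀..t, (1 - s / t) * i s / s) ^ p ≤ C * (i t * Real.log t ^ (p - 1))) : False := by
  have ht0 : 0 < t₀ := by linarith
  have hpos : ∀ s, t₀ ≤ s → 0 ≤ i s := fun s hs => hc.le.trans (hci s hs)
  -- enlarge `C` so that it is positive
  obtain ⟨K, hK, hKC⟩ : ∃ K : ℝ, 0 < K ∧ C ≤ K := ⟨max C 1, by positivity, le_max_left _ _⟩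
  set j : ℝ → ℝ := fun τ => i (Real.exp τ) with hj
  set a₀ : ℝ := Real.log t₀ with ha₀
  have ha₀0 : 0 ≤ a₀ := Real.log_nonneg ht₀
  have hexp : ∀ τ, a₀ ≤ τ → t₀ ≤ Real.exp τ := fun τ hτ => (Real.log_le_iff_le_exp ht0).1 hτ
  have key : ∀ {β δ τ m B : ℝ}, a₀ ≤ β → β ≤ δ → δ ≤ τ → 0 < τ → (∀ σ, β ≤ σ → m ≤ j σ) →
      0 ≤ m → 0 ≤ B → B * τ ≤ (1 - Real.exp (δ - τ)) * m * (δ - β) → B ^ p / K * τ ≤ j τ := by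
    intro β δ τ m B hβ hβδ hδ hτ hm hm0 hB hBle
    have h1 : (1 - Real.exp (δ - τ)) * m * (δ - β) ≤
        ∫ s in t₀..Real.exp τ, (1 - s / Real.exp τ) * i s / s := by
      have := le_integral_weight (t := Real.exp τ) (b := Real.exp β) (d := Real.exp δ) (m := m)
        ht0 hi hpos (hexp β hβ) (Real.exp_le_exp.2 hβδ) (Real.exp_le_exp.2 hδ) ?_ hm0
      · rwa [← Real.exp_sub, ← Real.exp_sub, Real.log_exp] at this
      · intro s hs
        have hs0 : 0 < s := (Real.exp_pos _).trans_le hs.1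
        have := hm (Real.log s) ((Real.le_log_iff_exp_le hs0).2 hs.1)
        simpa only [hj, Real.exp_log hs0] using this
    have hτ' : a₀ ≤ τ := hβ.trans (hβδ.trans hδ)
    have h2 := (Real.rpow_le_rpow (by positivity) (hBle.trans h1) (by linarith)).trans
      (h _ (hexp τ hτ'))
    rw [Real.log_exp, Real.mul_rpow hB hτ.le] at h2
    have h3 : C * (i (Real.exp τ) * τ ^ (p - 1)) ≤ K * (j τ * τ ^ (p - 1)) := by
      have := hpos _ (hexp τ hτ')
      gcongr
    have h4 : τ ^ p = τ * τ ^ (p - 1) := by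
      rw [Real.rpow_sub_one hτ.ne']
      field_simp
    have h5 : (B ^ p * τ) * τ ^ (p - 1) ≤ (K * j τ) * τ ^ (p - 1) := by
      calc (B ^ p * τ) * τ ^ (p - 1) = B ^ p * τ ^ p := by rw [h4]; ring
        _ ≤ _ := h2.trans h3
        _ = _ := by ring
    have h6 := le_of_mul_le_mul_right h5 (Real.rpow_pos_of_pos hτ _)
    rw [div_mul_eq_mul_div, div_le_iff₀ hK]
    linarith
  have hexp1 : Real.exp (-1) ≤ 1 / 2 := by
    have := Real.exp_one_gt_d9
    rw [Real.exp_neg, inv_eq_one_div]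
    gcongr
    linarith
  -- on the interval `[τ / 2, τ - 1]` of logarithmic times the kernel is at least `1 / 2`
  have half : ∀ {τ m B : ℝ}, 2 * a₀ ≤ τ → 4 ≤ τ → (∀ σ, τ / 2 ≤ σ → m ≤ j σ) → 0 ≤ m → 0 ≤ B →
      B ≤ m / 8 → B ^ p / K * τ ≤ j τ := by
    intro τ m B h1 h2 hm hm0 hB hBm
    refine key (β := τ / 2) (δ := τ - 1) (by linarith) (by linarith) (by linarith) (by linarith)
      hm hm0 hB ?_
    have e1 : τ - 1 - τ = -1 := by ring
    rw [e1]
    calc B * τ ≤ m / 8 * τ := by gcongr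
      _ = (1 - 1 / 2) * m * (τ / 4) := by ring
      _ ≤ _ := mul_le_mul (mul_le_mul_of_nonneg_right (by linarith) hm0) (by linarith)
        (by linarith) (mul_nonneg (by linarith) hm0)
  set A₁ : ℝ := (c / 8) ^ p / K with hA₁
  have hA₁0 : 0 < A₁ := by positivity
  have step1 : ∀ τ, 2 * a₀ + 4 ≤ τ → A₁ * τ ≤ j τ := fun τ hτ =>
    half (m := c) (by linarith) (by linarith) (fun σ hσ => hci _ (hexp σ (by linarith))) hc.le
      (by positivity) le_rfl
  have step2 : ∀ τ, 4 * a₀ + 8 ≤ τ → (A₁ * τ / 16) ^ p / K * τ ≤ j τ := fun τ hτ =>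
    half (m := A₁ * (τ / 2)) (by linarith) (by linarith)
      (fun σ hσ => le_trans (by gcongr) (step1 σ (by linarith)))
      (mul_nonneg hA₁0.le (by linarith)) (div_nonneg (mul_nonneg hA₁0.le (by linarith)) (by norm_num))
      (by linarith)
  have hp1 : 0 < p - 1 := by linarith
  -- `θ ^ p = 4 ^ p * θ` balances the loss `δ ^ 2 = 4 ^ (-l)` in the `l`-th step
  set θ : ℝ := (4 : ℝ) ^ (p / (p - 1)) with hθ
  have hθ0 : 0 < θ := by positivity
  have hθ1 : 1 < θ := Real.one_lt_rpow (by norm_num) (by positivity)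
  have hθp : θ ^ p = 4 ^ p * θ := by
    rw [hθ, ← Real.rpow_mul (by norm_num), ← Real.rpow_add (by norm_num)]
    congr 1
    field_simp
    ring
  set Λ : ℝ := ((16 : ℝ) ^ p * K * θ) ^ (1 / (p - 1)) with hΛ
  have hΛ0 : 0 < Λ := by positivity
  have hΛp : Λ ^ p = Λ * (16 ^ p * K * θ) := by
    have : Λ ^ (p - 1) = 16 ^ p * K * θ := by
      rw [hΛ, ← Real.rpow_mul (by positivity), one_div_mul_cancel hp1.ne', Real.rpow_one]
    rw [← this, Real.rpow_sub_one hΛ0.ne']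
    field_simp
  obtain ⟨a, haa, haΛ⟩ : ∃ a, 4 * a₀ + 8 ≤ a ∧ ∀ τ, a ≤ τ → Λ * τ ≤ j τ := by
    set B : ℝ := (K * Λ) ^ (1 / p) with hB
    have hB0 : 0 < B := by positivity
    refine ⟨max (4 * a₀ + 8) (16 * B / A₁), le_max_left _ _, fun τ hτ => ?_⟩
    have h1 : 4 * a₀ + 8 ≤ τ := (le_max_left _ _).trans hτ
    have h2 : B ≤ A₁ * τ / 16 := by
      have := (le_max_right _ _).trans hτ
      rw [div_le_iff₀ hA₁0] at this
      linarith
    refine le_trans ?_ (step2 τ h1)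
    have h3 : 0 ≤ τ := by linarith
    gcongr
    rw [le_div_iff₀ hK, mul_comm]
    calc K * Λ = B ^ p := by
          rw [hB, ← Real.rpow_mul (by positivity), one_div_mul_cancel (by linarith), Real.rpow_one]
      _ ≤ _ := by gcongr
  have main : ∀ l : ℕ, ∀ τ, a + 2 - 2 * (1 / 2) ^ l ≤ τ → Λ * θ ^ l * τ ≤ j τ := by
    intro l
    induction l with
    | zero =>
      intro τ hτ
      simpa using haΛ τ (by simpa using hτ)
    | succ l ih =>
      intro τ hτ
      set δ : ℝ := (1 / 2) ^ l with hδ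
      have hδ0 : 0 < δ := by positivity
      have hδ1 : δ ≤ 1 := pow_le_one₀ (by norm_num) (by norm_num)
      have hτ' : a + 2 - 2 * δ + δ ≤ τ := by
        rw [pow_succ] at hτ
        linarith
      have hτ8 : 8 ≤ τ := by linarith
      have hx : δ / 4 ≤ 1 - Real.exp (τ - δ / 2 - τ) := by
        have e1 : τ - δ / 2 - τ = -(δ / 2) := by ring
        have h3 := Real.add_one_le_exp (δ / 2)
        have h4 : Real.exp (-(δ / 2)) ≤ 1 / (1 + δ / 2) := by
          rw [Real.exp_neg, inv_eq_one_div]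
          gcongr
          linarith
        have h5 : 1 / (1 + δ / 2) ≤ 1 - δ / 4 := by
          rw [div_le_iff₀ (by positivity)]
          nlinarith
        rw [e1]
        linarith
      have := key (β := τ - δ) (δ := τ - δ / 2) (τ := τ) (m := Λ * θ ^ l * (τ / 2))
        (B := Λ * θ ^ l * (δ ^ 2 / 16)) (by linarith) (by linarith) (by linarith) (by linarith)
        (fun σ hσ => le_trans (by gcongr; linarith) (ih σ (by linarith))) (by positivity)
        (by positivity) ?_
      · refine le_of_eq_of_le ?_ this
        have hδ2 : δ ^ 2 = (1 / 4) ^ l := by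
          rw [hδ, ← pow_mul, mul_comm, pow_mul]
          norm_num
        have e2 : (θ ^ l) ^ p = (4 ^ l) ^ p * θ ^ l := by
          rw [← Real.rpow_natCast θ l, ← Real.rpow_mul hθ0.le, mul_comm (l : ℝ) p,
            Real.rpow_mul hθ0.le, hθp, Real.rpow_natCast, mul_pow, ← Real.rpow_natCast,
            ← Real.rpow_mul (by norm_num), ← Real.rpow_natCast (4 : ℝ) l,
            ← Real.rpow_mul (by norm_num), mul_comm p, Real.rpow_natCast θ l]
        have e3 : Λ * θ ^ l * (δ ^ 2 / 16) = Λ * θ ^ l / (4 ^ l * 16) := by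
          rw [hδ2, one_div, inv_pow]
          field_simp
        rw [e3, Real.div_rpow (by positivity) (by positivity),
          Real.mul_rpow hΛ0.le (by positivity), e2, hΛp,
          Real.mul_rpow (by positivity) (by norm_num)]
        field_simp
        ring
      · calc Λ * θ ^ l * (δ ^ 2 / 16) * τ = δ / 4 * (Λ * θ ^ l * (τ / 2)) * (δ / 2) := by ring
          _ ≤ _ := mul_le_mul (mul_le_mul_of_nonneg_right hx (by positivity)) (by linarith)
            (by linarith) (mul_nonneg (by linarith) (by positivity))
  obtain ⟨l, hl⟩ := pow_unbounded_of_one_lt (j (a + 2) / (Λ * (a + 2))) hθ1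
  have ha2 : 0 < a + 2 := by linarith
  have h1 := main l (a + 2) (by linarith [show (0 : ℝ) ≤ (1 / 2) ^ l by positivity])
  rw [div_lt_iff₀ (by positivity)] at hl
  nlinarith

/-! ### Solutions of the transformed wave equation -/

section Wave

variable {n : ℕ}

/-- The closed half-space-time `[0, ∞) × ℝⁿ`. -/
def futureHalf (n : ℕ) : Set (ℝ × EuclideanSpace ℝ (Fin n)) := Ici 0 ×ˢ univ

/-- The time derivative, one-sided at time `0`. -/
noncomputable def dt (u : ℝ × EuclideanSpace ℝ (Fin n) → ℝ) (z : ℝ × EuclideanSpace ℝ (Fin n)) : ℝ :=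
  fderivWithin ℝ u (futureHalf n) z (1, 0)

/-- The spatial unit vector `(0, eᵢ)` in space-time. -/
noncomputable def spaceDir (i : Fin n) : ℝ × EuclideanSpace ℝ (Fin n) := (0, EuclideanSpace.single i 1)

/-- The `i`-th spatial partial derivative on `[0, ∞) × ℝⁿ`. -/
noncomputable def dx (u : ℝ × EuclideanSpace ℝ (Fin n) → ℝ) (i : Fin n) (z : ℝ × EuclideanSpace ℝ (Fin n)) : ℝ :=
  fderivWithin ℝ u (futureHalf n) z (spaceDir i)

/-- The d'Alembertian `∂ₜ² - Δ` at positive times. -/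
noncomputable def box (u : ℝ × EuclideanSpace ℝ (Fin n) → ℝ) (z : ℝ × EuclideanSpace ℝ (Fin n)) : ℝ :=
  fderiv ℝ (dt u) z (1, 0) - ∑ i, fderiv ℝ (dx u i) z (spaceDir i)

/-- `u` is a global `C²` solution of `u_tt - Δ u = (1 + t) ^ (-κ) |u| ^ p`. -/
structure IsWaveSolution (κ p : ℝ) (u : ℝ × EuclideanSpace ℝ (Fin n) → ℝ) : Prop where
  contDiffOn : ContDiffOn ℝ 2 u (futureHalf n)
  equation : ∀ z, 0 < z.1 → box u z = (1 + z.1) ^ (-κ) * |u z| ^ p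

theorem uniqueDiffOn_futureHalf : UniqueDiffOn ℝ (futureHalf n) :=
  (uniqueDiffOn_Ici 0).prod uniqueDiffOn_univ

theorem Ioi_prod_subset_futureHalf :
    Ioi (0 : ℝ) ×ˢ (univ : Set (EuclideanSpace ℝ (Fin n))) ⊆ futureHalf n :=
  prod_mono Ioi_subset_Ici_self Subset.rfl

theorem futureHalf_mem_nhds {z : ℝ × EuclideanSpace ℝ (Fin n)} (hz : 0 < z.1) :
    futureHalf n ∈ 𝓝 z :=
  mem_of_superset (isOpen_Ioi_prod_univ.mem_nhds ⟨hz, mem_univ _⟩) Ioi_prod_subset_futureHalf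

variable {u : ℝ × EuclideanSpace ℝ (Fin n) → ℝ} {z : ℝ × EuclideanSpace ℝ (Fin n)}

theorem continuousOn_fderivWithin_futureHalf (hu : ContDiffOn ℝ 2 u (futureHalf n))
    (w : ℝ × EuclideanSpace ℝ (Fin n)) :
    ContinuousOn (fun z => fderivWithin ℝ u (futureHalf n) z w) (futureHalf n) :=
  (hu.continuousOn_fderivWithin uniqueDiffOn_futureHalf (by norm_num)).clm_apply continuousOn_const

theorem contDiffOn_fderivWithin_futureHalf (hu : ContDiffOn ℝ 2 u (futureHalf n))
    (w : ℝ × EuclideanSpace ℝ (Fin n)) :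
    ContDiffOn ℝ 1 (fun z => fderivWithin ℝ u (futureHalf n) z w) (Ioi (0 : ℝ) ×ˢ univ) :=
  ((hu.fderivWithin uniqueDiffOn_futureHalf (m := 1) (by norm_num)).clm_apply
    contDiffOn_const).mono Ioi_prod_subset_futureHalf

theorem continuousOn_dt (hu : ContDiffOn ℝ 2 u (futureHalf n)) :
    ContinuousOn (dt u) (futureHalf n) := continuousOn_fderivWithin_futureHalf hu _

theorem continuousOn_dx (hu : ContDiffOn ℝ 2 u (futureHalf n)) (i : Fin n) :
    ContinuousOn (dx u i) (futureHalf n) := continuousOn_fderivWithin_futureHalf hu _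

theorem contDiffOn_dt (hu : ContDiffOn ℝ 2 u (futureHalf n)) :
    ContDiffOn ℝ 1 (dt u) (Ioi (0 : ℝ) ×ˢ univ) := contDiffOn_fderivWithin_futureHalf hu _

theorem contDiffOn_dx (hu : ContDiffOn ℝ 2 u (futureHalf n)) (i : Fin n) :
    ContDiffOn ℝ 1 (dx u i) (Ioi (0 : ℝ) ×ˢ univ) := contDiffOn_fderivWithin_futureHalf hu _

theorem fderiv_apply_time (hz : 0 < z.1) : fderiv ℝ u z (1, 0) = dt u z := by
  rw [dt, fderivWithin_of_mem_nhds (futureHalf_mem_nhds hz)]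

theorem fderiv_apply_space (hz : 0 < z.1) (i : Fin n) :
    fderiv ℝ u z (spaceDir i) = dx u i z := by
  rw [dx, fderivWithin_of_mem_nhds (futureHalf_mem_nhds hz)]

theorem fderiv_fderivWithin_apply (hu : ContDiffOn ℝ 2 u (futureHalf n)) (hz : 0 < z.1)
    (w w' : ℝ × EuclideanSpace ℝ (Fin n)) :
    fderiv ℝ (fun y => fderivWithin ℝ u (futureHalf n) y w) z w' =
      fderiv ℝ (fderiv ℝ u) z w' w := by
  have h1 : (fun y => fderivWithin ℝ u (futureHalf n) y w) =ᶠ[𝓝 z] fun y => fderiv ℝ u y w := by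
    filter_upwards [isOpen_Ioi_prod_univ.mem_nhds ⟨hz, mem_univ _⟩] with y hy
    rw [fderivWithin_of_mem_nhds (futureHalf_mem_nhds hy.1)]
  have h2 : DifferentiableAt ℝ (fderiv ℝ u) z :=
    ((hu.contDiffAt (futureHalf_mem_nhds hz)).fderiv_right (m := 1) (by norm_num)).differentiableAt
      one_ne_zero
  rw [h1.fderiv_eq, fderiv_clm_apply h2 (differentiableAt_const w)]
  simp

theorem fderiv_dt_space (hu : ContDiffOn ℝ 2 u (futureHalf n)) (hz : 0 < z.1) (i : Fin n) :
    fderiv ℝ (dt u) z (spaceDir i) = fderiv ℝ (dx u i) z (1, 0) := by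
  have h := (hu.contDiffAt (futureHalf_mem_nhds hz)).isSymmSndFDerivAt (by simp)
  refine (fderiv_fderivWithin_apply hu hz _ _).trans ?_
  rw [h.eq]
  exact (fderiv_fderivWithin_apply hu hz _ _).symm

end Wave

/-! ### Finite speed of propagation -/

theorem hasDerivAt_max_zero_sq (y : ℝ) : HasDerivAt (fun y : ℝ => max y 0 ^ 2) (2 * max y 0) y := by
  rcases lt_trichotomy y 0 with hy | rfl | hy
  · rw [max_eq_right hy.le, mul_zero]
    refine (hasDerivAt_const y (0 : ℝ)).congr_of_eventuallyEq ?_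
    filter_upwards [gt_mem_nhds hy] with x hx
    simp [max_eq_right hx.le]
  · rw [max_self, mul_zero, hasDerivAt_iff_isLittleO_nhds_zero]
    have h2 : (fun h : ℝ => h ^ 2) =o[𝓝 0] fun h => h := by
      simpa using Asymptotics.isLittleO_pow_pow (𝕜 := ℝ) (m := 1) (n := 2) one_lt_two
    refine (Asymptotics.IsBigO.of_bound 1 (Eventually.of_forall fun h => ?_)).trans_isLittleO h2
    simp only [zero_add, max_self, smul_zero, sub_zero, one_mul, norm_pow, Real.norm_eq_abs]
    norm_num
    rw [← sq_abs h]
    gcongr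
    exact max_le (le_abs_self h) (abs_nonneg h)
  · rw [max_eq_left hy.le]
    have : HasDerivAt (fun y : ℝ => y ^ 2) (2 * y) y := by simpa using hasDerivAt_pow 2 y
    refine this.congr_of_eventuallyEq ?_
    filter_upwards [lt_mem_nhds hy] with x hx
    simp [max_eq_left hx.le]

theorem contDiff_max_zero_sq : ContDiff ℝ 1 fun y : ℝ => max y 0 ^ 2 := by
  rw [contDiff_one_iff_deriv]
  refine ⟨fun y => (hasDerivAt_max_zero_sq y).differentiableAt, ?_⟩
  have : deriv (fun y : ℝ => max y 0 ^ 2) = fun y => 2 * max y 0 :=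
    funext fun y => (hasDerivAt_max_zero_sq y).deriv
  rw [this]
  fun_prop

section Cone

variable {n : ℕ}

/-- The Lorentzian quadratic form centred at the apex `(r, c)`; it is nonnegative exactly on the
light cone with this apex. -/
noncomputable def lorentz (r : ℝ) (c : EuclideanSpace ℝ (Fin n)) (z : ℝ × EuclideanSpace ℝ (Fin n)) : ℝ :=
  (r - z.1) ^ 2 - ‖z.2 - c‖ ^ 2

/-- A `C¹` weight supported in the light cone with apex `(r, c)`. -/
noncomputable def coneWeight (r : ℝ) (c : EuclideanSpace ℝ (Fin n)) (z : ℝ × EuclideanSpace ℝ (Fin n)) : ℝ :=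
  max (lorentz r c z) 0 ^ 2

variable {r : ℝ} {c : EuclideanSpace ℝ (Fin n)}

theorem contDiff_lorentz {m : WithTop ℕ∞} : ContDiff ℝ m (lorentz r c) := by
  unfold lorentz
  exact ((contDiff_const.sub contDiff_fst).pow 2).sub ((contDiff_snd.sub contDiff_const).norm_sq ℝ)

theorem contDiff_coneWeight : ContDiff ℝ 1 (coneWeight r c) :=
  contDiff_max_zero_sq.comp contDiff_lorentz

theorem coneWeight_nonneg (z : ℝ × EuclideanSpace ℝ (Fin n)) : 0 ≤ coneWeight r c z :=
  sq_nonneg _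

theorem fderiv_lorentz (z w : ℝ × EuclideanSpace ℝ (Fin n)) :
    fderiv ℝ (lorentz r c) z w = -2 * (r - z.1) * w.1 - 2 * inner ℝ (z.2 - c) w.2 := by
  have h1 : HasFDerivAt (fun z : ℝ × EuclideanSpace ℝ (Fin n) => z.2 - c)
    (ContinuousLinearMap.snd ℝ ℝ _) z := hasFDerivAt_snd.sub_const c
  have h2 : HasFDerivAt (fun z : ℝ × EuclideanSpace ℝ (Fin n) => r - z.1)
    (-ContinuousLinearMap.fst ℝ ℝ (EuclideanSpace ℝ (Fin n))) z := hasFDerivAt_fst.const_sub r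
  have h3 : HasFDerivAt (lorentz r c) _ z := (h2.pow 2).sub h1.norm_sq
  rw [h3.fderiv]
  simp [inner_sub_left]

theorem fderiv_coneWeight (z w : ℝ × EuclideanSpace ℝ (Fin n)) :
    fderiv ℝ (coneWeight r c) z w = 2 * max (lorentz r c z) 0 * fderiv ℝ (lorentz r c) z w := by
  have h := (hasDerivAt_max_zero_sq (lorentz r c z)).comp_hasFDerivAt z
    ((contDiff_lorentz (m := 1)).differentiable one_ne_zero z).hasFDerivAt
  have h' : HasFDerivAt (coneWeight r c) _ z := h
  rw [h'.fderiv]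
  simp

theorem lorentz_neg {z : ℝ × EuclideanSpace ℝ (Fin n)} (h0 : 0 ≤ z.1) (hr : z.1 ≤ r)
    (hz : r < dist z.2 c) : lorentz r c z < 0 := by
  rw [dist_eq_norm] at hz
  unfold lorentz
  nlinarith

/-- The energy density `(u_t² + |∇u|² + u²) / 2`. -/
noncomputable def energyDensity (u : ℝ × EuclideanSpace ℝ (Fin n) → ℝ) (z : ℝ × EuclideanSpace ℝ (Fin n)) : ℝ :=
  1 / 2 * (dt u z ^ 2 + ∑ i, dx u i z ^ 2 + u z ^ 2)

variable {u : ℝ × EuclideanSpace ℝ (Fin n) → ℝ} {z : ℝ × EuclideanSpace ℝ (Fin n)}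

theorem energyDensity_nonneg : 0 ≤ energyDensity u z := by
  unfold energyDensity
  positivity

theorem contDiffOn_energyDensity (hu : ContDiffOn ℝ 2 u (futureHalf n)) :
    ContDiffOn ℝ 1 (energyDensity u) (Ioi (0 : ℝ) ×ˢ univ) :=
  contDiffOn_const.mul ((((contDiffOn_dt hu).pow 2).add
    (ContDiffOn.sum fun i _ => (contDiffOn_dx hu i).pow 2)).add
    (((hu.mono Ioi_prod_subset_futureHalf).of_le (by norm_num)).pow 2))

theorem continuousOn_energyDensity (hu : ContDiffOn ℝ 2 u (futureHalf n)) :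
    ContinuousOn (energyDensity u) (futureHalf n) :=
  continuousOn_const.mul ((((continuousOn_dt hu).pow 2).add
    (continuousOn_finsetSum _ fun i _ => (continuousOn_dx hu i).pow 2)).add
    (hu.continuousOn.pow 2))

/-- The local energy identity, weighted by `ψ`. -/
theorem energy_identity (hu : ContDiffOn ℝ 2 u (futureHalf n)) (hz : 0 < z.1)
    {ψ : ℝ × EuclideanSpace ℝ (Fin n) → ℝ} (hψ : DifferentiableAt ℝ ψ z) :
    fderiv ℝ (fun z => energyDensity u z * ψ z) z (1, 0)
      - ∑ i, fderiv ℝ (fun z => ψ z * (dt u z * dx u i z)) z (spaceDir i) =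
    ψ z * (dt u z * (box u z + u z)) + (energyDensity u z * fderiv ℝ ψ z (1, 0)
      - dt u z * ∑ i, fderiv ℝ ψ z (spaceDir i) * dx u i z) := by
  have ha := (contDiffOn_differentiableAt (contDiffOn_dt hu) hz).hasFDerivAt
  have hb := fun i => (contDiffOn_differentiableAt (contDiffOn_dx hu i) hz).hasFDerivAt
  have huz := (contDiffOn_differentiableAt
    ((hu.mono Ioi_prod_subset_futureHalf).of_le (by norm_num)) hz).hasFDerivAt
  have he : HasFDerivAt (energyDensity u) _ z :=
    (((ha.pow 2).add (HasFDerivAt.fun_sum (u := Finset.univ) fun i _ => (hb i).pow 2)).add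
      (huz.pow 2)).const_mul (1 / 2)
  have h1 := (he.mul hψ.hasFDerivAt).fderiv
  have h2 := fun i => (hψ.hasFDerivAt.mul (ha.mul (hb i))).fderiv
  have e1 : (fun z => energyDensity u z * ψ z) = energyDensity u * ψ := rfl
  have e2 : ∀ i, (fun z => ψ z * (dt u z * dx u i z)) = ψ * (dt u * dx u i) := fun i => rfl
  simp only [e1, e2, h1, h2]
  simp only [_root_.add_apply, _root_.smul_apply, smul_eq_mul,
    _root_.sum_apply, Pi.mul_apply, fderiv_dt_space hu hz, fderiv_apply_time (u := u) hz, box]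
  have s1 : ∑ i, 2 • dx u i z ^ (2 - 1) * fderiv ℝ (dx u i) z (1, 0) =
      2 * ∑ i, dx u i z * fderiv ℝ (dx u i) z (1, 0) := by
    rw [Finset.mul_sum]
    refine Finset.sum_congr rfl fun i _ => ?_
    simp
    ring
  have s2 : ∑ i, (ψ z * (dt u z * fderiv ℝ (dx u i) z (spaceDir i)
        + dx u i z * fderiv ℝ (dx u i) z (1, 0)) + dt u z * dx u i z * fderiv ℝ ψ z (spaceDir i)) =
      ψ z * dt u z * ∑ i, fderiv ℝ (dx u i) z (spaceDir i)
        + ψ z * ∑ i, dx u i z * fderiv ℝ (dx u i) z (1, 0)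
        + dt u z * ∑ i, fderiv ℝ ψ z (spaceDir i) * dx u i z := by
    simp only [Finset.mul_sum, ← Finset.sum_add_distrib]
    refine Finset.sum_congr rfl fun i _ => ?_
    ring
  rw [s1, s2]
  simp
  ring

/-- The flux through the lateral boundary of the cone has a sign: the weight decreases in time at
least as fast as it varies in space. -/
theorem coneWeight_flux_nonpos (hr : z.1 ≤ r) :
    energyDensity u z * fderiv ℝ (coneWeight r c) z (1, 0)
      - dt u z * ∑ i, fderiv ℝ (coneWeight r c) z (spaceDir i) * dx u i z ≤ 0 := by
  simp only [fderiv_coneWeight, fderiv_lorentz, spaceDir]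
  have e1 : ∑ i, 2 * max (lorentz r c z) 0 * (-2 * (r - z.1) * 0
      - 2 * inner ℝ (z.2 - c) (EuclideanSpace.single i 1)) * dx u i z =
      -(4 * max (lorentz r c z) 0) * ∑ i, (z.2 - c) i * dx u i z := by
    rw [Finset.mul_sum]
    refine Finset.sum_congr rfl fun i _ => ?_
    rw [EuclideanSpace.inner_single_right]
    simp
    ring
  rw [e1]
  simp only [inner_zero_right]
  rcases le_or_gt (lorentz r c z) 0 with hm | hm
  · rw [max_eq_right hm]
    simp
  · have hR : 0 ≤ r - z.1 := by linarith
    have hle : ‖z.2 - c‖ ^ 2 ≤ (r - z.1) ^ 2 := by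
      unfold lorentz at hm
      linarith
    have hcs := Finset.sum_mul_sq_le_sq_mul_sq Finset.univ (fun i => (z.2 - c) i)
      (fun i => dx u i z)
    rw [← EuclideanSpace.real_norm_sq_eq] at hcs
    set B : ℝ := ∑ i, dx u i z ^ 2 with hB
    set Q : ℝ := ∑ i, (z.2 - c) i * dx u i z with hQ
    have hB0 : 0 ≤ B := by positivity
    have hQ2 : Q ^ 2 ≤ (r - z.1) ^ 2 * B := hcs.trans (by gcongr)
    have h1 : dt u z * Q ≤ (r - z.1) * ((dt u z ^ 2 + B) / 2) := by
      refine le_of_abs_le (abs_le_of_sq_le_sq ?_ (by positivity))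
      have h2 : dt u z ^ 2 * B ≤ ((dt u z ^ 2 + B) / 2) ^ 2 := by
        nlinarith [sq_nonneg (dt u z ^ 2 - B)]
      calc (dt u z * Q) ^ 2 = dt u z ^ 2 * Q ^ 2 := by ring
        _ ≤ dt u z ^ 2 * ((r - z.1) ^ 2 * B) := by gcongr
        _ = (r - z.1) ^ 2 * (dt u z ^ 2 * B) := by ring
        _ ≤ (r - z.1) ^ 2 * ((dt u z ^ 2 + B) / 2) ^ 2 := by gcongr
        _ = _ := by ring
    have h2 : (r - z.1) * ((dt u z ^ 2 + B) / 2) ≤ (r - z.1) * energyDensity u z := by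
      refine mul_le_mul_of_nonneg_left ?_ hR
      unfold energyDensity
      rw [← hB]
      nlinarith [sq_nonneg (u z)]
    rw [max_eq_left hm.le]
    have h3 : 0 ≤ 4 * lorentz r c z * ((r - z.1) * energyDensity u z - dt u z * Q) :=
      mul_nonneg (by linarith) (by linarith)
    linarith

/-- If the Cauchy data vanish on the base of a backward light cone, so does a `C²` function with
`|u_tt - Δu| ≤ L |u|` in the cone. -/
theorem eq_zero_of_data_eq_zero (hu : ContDiffOn ℝ 2 u (futureHalf n)) {L t₀ : ℝ} (hL : 0 ≤ L)
    (ht₀ : 0 < t₀) (hr : t₀ < r)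
    (hbox : ∀ z, 0 < z.1 → z.1 < t₀ → dist z.2 c ≤ r → |box u z| ≤ L * |u z|)
    (h0 : ∀ x, dist x c ≤ r → u (0, x) = 0)
    (h1 : ∀ x, dist x c ≤ r → dt u (0, x) = 0)
    (h2 : ∀ x, dist x c ≤ r → ∀ i, dx u i (0, x) = 0) : u (t₀, c) = 0 := by
  set F : ℝ × EuclideanSpace ℝ (Fin n) → ℝ := fun z => energyDensity u z * coneWeight r c z with hF
  have hψ0 : ∀ s ∈ Icc 0 t₀, ∀ x, r < dist x c → coneWeight r c (s, x) = 0 := by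
    intro s hs x hx
    have := lorentz_neg (r := r) (c := c) (z := (s, x)) hs.1 (by linarith [hs.2]) hx
    simp [coneWeight, max_eq_right this.le]
  have hFcont : ContinuousOn F (futureHalf n) :=
    (continuousOn_energyDensity hu).mul contDiff_coneWeight.continuous.continuousOn
  have hFC : ContDiffOn ℝ 1 F (Ioi (0 : ℝ) ×ˢ univ) :=
    (contDiffOn_energyDensity hu).mul contDiff_coneWeight.contDiffOn
  have hF0 : ∀ s ∈ Icc 0 t₀, ∀ x, r < dist x c → F (s, x) = 0 := by
    intro s hs x hx
    simp [hF, hψ0 s hs x hx]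
  set En : ℝ → ℝ := fun s => ∫ x, F (s, x) with hEn
  have hEcont : ContinuousOn En (Icc 0 t₀) := by
    refine continuousOn_integral_of_compact_support (isCompact_closedBall c r)
      (f := fun s x => F (s, x)) (hFcont.mono ?_) ?_
    · exact prod_mono Icc_subset_Ici_self Subset.rfl
    · intro s x hs hx
      exact hF0 s hs x (by simpa using hx)
  have hEder : ∀ s ∈ Ioo 0 t₀,
      HasDerivAt En (∫ x, fderiv ℝ F (s, x) (1, 0)) s := fun s hs =>
    hasDerivAt_integral_slice volume hFC le_rfl hs fun r hr => hF0 r (Ioo_subset_Icc_self hr)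
  have hEle : ∀ s ∈ Ioo 0 t₀, (∫ x, fderiv ℝ F (s, x) (1, 0)) ≤ (L + 1) * En s := by
    intro s hs
    set Φ : Fin n → ℝ × EuclideanSpace ℝ (Fin n) → ℝ :=
      fun i z => coneWeight r c z * (dt u z * dx u i z) with hΦ
    have hΦC : ∀ i, ContDiffOn ℝ 1 (Φ i) (Ioi (0 : ℝ) ×ˢ univ) := fun i =>
      contDiff_coneWeight.contDiffOn.mul ((contDiffOn_dt hu).mul (contDiffOn_dx hu i))
    have hΦ0 : ∀ i, ∀ r' ∈ Ioo 0 t₀, ∀ x, r < dist x c → Φ i (r', x) = 0 := by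
      intro i r' hr' x hx
      simp [hΦ, hψ0 r' (Ioo_subset_Icc_self hr') x hx]
    have hdiv : ∀ i, ∫ x, fderiv ℝ (Φ i) (s, x) (spaceDir i) = 0 := fun i =>
      integral_fderiv_space_eq_zero volume (hΦC i) hs.1 (hΦ0 i s hs) _
    have hΦint : ∀ i, Integrable fun x => fderiv ℝ (Φ i) (s, x) (spaceDir i) := fun i =>
      integrable_slice volume (fderiv_apply_contDiffOn (m' := 0) (hΦC i) (by simp) _).continuousOn
        hs.1 fun x hx => by rw [fderiv_eq_zero_of_lt_dist (hΦ0 i) hs hx]; simp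
    have hFint : Integrable fun x => fderiv ℝ F (s, x) (1, 0) :=
      integrable_slice volume (fderiv_apply_contDiffOn (m' := 0) hFC (by simp) _).continuousOn
        hs.1 fun x hx => by
          rw [fderiv_eq_zero_of_lt_dist (fun r' hr' => hF0 r' (Ioo_subset_Icc_self hr')) hs hx]
          simp
    have hsum : ∫ x, fderiv ℝ F (s, x) (1, 0) =
        ∫ x, (fderiv ℝ F (s, x) (1, 0) - ∑ i, fderiv ℝ (Φ i) (s, x) (spaceDir i)) := by
      rw [integral_sub hFint (integrable_finsetSum _ fun i _ => hΦint i),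
        integral_finsetSum _ fun i _ => hΦint i]
      simp [hdiv]
    rw [hsum, hEn, ← integral_const_mul]
    refine integral_mono (hFint.sub (integrable_finsetSum _ fun i _ => hΦint i))
      ((integrable_slice volume hFC.continuousOn hs.1
        (hF0 s (Ioo_subset_Icc_self hs))).const_mul _) fun x => ?_
    have hid := energy_identity (z := (s, x)) hu hs.1
      (contDiff_coneWeight (r := r) (c := c) |>.differentiable one_ne_zero _)
    refine hid.le.trans ?_
    have hfl := coneWeight_flux_nonpos (u := u) (c := c) (r := r) (z := (s, x))
      (by linarith [hs.2])
    have hψn := coneWeight_nonneg (r := r) (c := c) (s, x)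
    simp only [hF]
    rcases lt_or_ge r (dist x c) with hx | hx
    · rw [hψ0 s (Ioo_subset_Icc_self hs) x hx]
      linarith
    · have hb := hbox (s, x) hs.1 hs.2 hx
      have h3 : dt u (s, x) * (box u (s, x) + u (s, x)) ≤ (L + 1) * energyDensity u (s, x) := by
        have hS : 0 ≤ ∑ i, dx u i (s, x) ^ 2 := by positivity
        have h4 : |box u (s, x) + u (s, x)| ≤ (L + 1) * |u (s, x)| :=
          (abs_add_le _ _).trans (by linarith)
        have h5 : |dt u (s, x)| * |u (s, x)| ≤ energyDensity u (s, x) := by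
          unfold energyDensity
          nlinarith [sq_nonneg (|dt u (s, x)| - |u (s, x)|), sq_abs (dt u (s, x)),
            sq_abs (u (s, x))]
        calc dt u (s, x) * (box u (s, x) + u (s, x))
            ≤ |dt u (s, x)| * |box u (s, x) + u (s, x)| := by
              rw [← abs_mul]
              exact le_abs_self _
          _ ≤ |dt u (s, x)| * ((L + 1) * |u (s, x)|) := by gcongr
          _ = (L + 1) * (|dt u (s, x)| * |u (s, x)|) := by ring
          _ ≤ _ := by gcongr
      have h6 := mul_le_mul_of_nonneg_left h3 hψn
      linarith
  have hanti : AntitoneOn (fun s => Real.exp (-(L + 1) * s) * En s) (Icc 0 t₀) := by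
    refine antitoneOn_of_deriv_nonpos (convex_Icc 0 t₀)
      (ContinuousOn.mul (by fun_prop) hEcont) ?_ ?_
    · intro s hs
      rw [interior_Icc] at hs
      exact (DifferentiableAt.mul (by fun_prop) (hEder s hs).differentiableAt).differentiableWithinAt
    · intro s hs
      rw [interior_Icc] at hs
      have hd : HasDerivAt (fun s => Real.exp (-(L + 1) * s))
          (Real.exp (-(L + 1) * s) * (-(L + 1))) s := by
        simpa using ((hasDerivAt_id s).const_mul (-(L + 1))).exp
      have hd' : HasDerivAt (fun s => Real.exp (-(L + 1) * s) * En s) _ s := hd.mul (hEder s hs)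
      rw [hd'.deriv]
      have h3 := mul_le_mul_of_nonneg_left (hEle s hs) (Real.exp_pos (-(L + 1) * s)).le
      linarith
  have hE0 : En 0 = 0 := by
    have : ∀ x, F (0, x) = 0 := by
      intro x
      rcases lt_or_ge r (dist x c) with hx | hx
      · exact hF0 0 ⟨le_rfl, ht₀.le⟩ x hx
      · simp [hF, energyDensity, h0 x hx, h1 x hx, h2 x hx]
    simp [hEn, this]
  have hFn : ∀ x, 0 ≤ F (t₀, x) := fun x =>
    mul_nonneg energyDensity_nonneg (coneWeight_nonneg _)
  have hEt : En t₀ = 0 := by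
    have h3 := hanti ⟨le_rfl, ht₀.le⟩ ⟨ht₀.le, le_rfl⟩ ht₀.le
    simp only [hE0, mul_zero] at h3
    have h4 : 0 ≤ En t₀ := integral_nonneg hFn
    nlinarith [Real.exp_pos (-(L + 1) * t₀)]
  have hFz : (fun x => F (t₀, x)) = 0 := by
    have h3 := (integral_eq_zero_iff_of_nonneg hFn
      (integrable_slice volume hFC.continuousOn ht₀ (hF0 t₀ ⟨ht₀.le, le_rfl⟩))).1 hEt
    exact (Continuous.ae_eq_iff_eq volume (continuous_slice hFC.continuousOn ht₀)
      continuous_zero).1 h3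
  have h3 : energyDensity u (t₀, c) * coneWeight r c (t₀, c) = 0 := congrFun hFz c
  have h4 : coneWeight r c (t₀, c) ≠ 0 := by
    have : 0 < (r - t₀) ^ 2 := by
      have : 0 < r - t₀ := by linarith
      positivity
    simp only [coneWeight, lorentz, sub_self, norm_zero]
    rw [max_eq_left (by simpa using this.le)]
    simp only [ne_eq, OfNat.ofNat_ne_zero, not_false_eq_true, zero_pow, sub_zero]
    positivity
  have h5 : energyDensity u (t₀, c) = 0 := (mul_eq_zero.1 h3).resolve_right h4
  have hS : 0 ≤ ∑ i, dx u i (t₀, c) ^ 2 := by positivity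
  unfold energyDensity at h5
  nlinarith [sq_nonneg (dt u (t₀, c)), sq_nonneg (u (t₀, c))]

/-- Finite speed of propagation: data supported in the ball of radius `R₀` give a solution
supported in `‖x‖ ≤ t + R₀`. -/
theorem IsWaveSolution.eq_zero_of_lt_norm {κ p R₀ : ℝ} (hκ : 0 ≤ κ) (hp : 1 < p)
    (h : IsWaveSolution κ p u) (h0 : ∀ x, R₀ < ‖x‖ → u (0, x) = 0)
    (h1 : ∀ x, R₀ < ‖x‖ → dt u (0, x) = 0) (h2 : ∀ x, R₀ < ‖x‖ → ∀ i, dx u i (0, x) = 0)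
    {t : ℝ} (ht : 0 ≤ t) {x : EuclideanSpace ℝ (Fin n)} (hx : t + R₀ < ‖x‖) : u (t, x) = 0 := by
  rcases ht.eq_or_lt with rfl | ht
  · exact h0 x (by linarith)
  -- the base of a slightly larger backward cone is still disjoint from the support of the data
  obtain ⟨r, htr, hrx⟩ : ∃ r, t < r ∧ r < ‖x‖ - R₀ := exists_between (by linarith)
  have hout : ∀ y, dist y x ≤ r → R₀ < ‖y‖ := by
    intro y hy
    rw [dist_eq_norm, ← norm_neg, neg_sub] at hy
    linarith [norm_sub_norm_le x y]
  have hK : IsCompact (Icc 0 t ×ˢ Metric.closedBall x r) :=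
    isCompact_Icc.prod (isCompact_closedBall x r)
  obtain ⟨M, hM⟩ := hK.exists_bound_of_continuousOn
    (h.contDiffOn.continuousOn.mono (prod_mono Icc_subset_Ici_self (subset_univ _)))
  have hM0 : 0 ≤ M := (norm_nonneg _).trans
    (hM (0, x) ⟨⟨le_rfl, ht.le⟩, Metric.mem_closedBall_self (by linarith)⟩)
  refine eq_zero_of_data_eq_zero h.contDiffOn (L := M ^ (p - 1)) (by positivity) ht htr ?_
    (fun y hy => h0 y (hout y hy)) (fun y hy => h1 y (hout y hy)) (fun y hy => h2 y (hout y hy))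
  intro z hz hzt hzd
  rw [h.equation z hz, abs_mul, abs_of_nonneg (by positivity : (0 : ℝ) ≤ |u z| ^ p),
    abs_of_nonneg (by positivity : (0 : ℝ) ≤ (1 + z.1) ^ (-κ))]
  have h3 : (1 + z.1) ^ (-κ) ≤ 1 := Real.rpow_le_one_of_one_le_of_nonpos (by linarith) (by linarith)
  have h4 : |u z| ^ p = |u z| ^ (p - 1) * |u z| := by
    rcases eq_or_ne (u z) 0 with h5 | h5
    · simp [h5, Real.zero_rpow (by linarith : p ≠ 0)]
    · rw [Real.rpow_sub_one (abs_ne_zero.2 h5)]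
      field_simp
  have h5 : |u z| ≤ M := hM z ⟨⟨hz.le, hzt.le⟩, hzd⟩
  calc (1 + z.1) ^ (-κ) * |u z| ^ p ≤ 1 * |u z| ^ p := by gcongr
    _ = |u z| ^ (p - 1) * |u z| := by rw [one_mul, h4]
    _ ≤ M ^ (p - 1) * |u z| := by
      have : 0 ≤ p - 1 := by linarith
      gcongr

end Cone

/-! ### Testing the equation against solutions of the free wave equation -/

section Duality

variable {n : ℕ}

theorem fderivWithin_futureHalf_eq {H : ℝ × EuclideanSpace ℝ (Fin n) → ℝ} (hH : ContDiff ℝ 1 H)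
    {z : ℝ × EuclideanSpace ℝ (Fin n)} (hz : 0 ≤ z.1) :
    fderivWithin ℝ H (futureHalf n) z = fderiv ℝ H z :=
  (hH.differentiable one_ne_zero z).fderivWithin (uniqueDiffOn_futureHalf z ⟨hz, mem_univ _⟩)

theorem dt_eq_fderiv {H : ℝ × EuclideanSpace ℝ (Fin n) → ℝ} (hH : ContDiff ℝ 1 H)
    {z : ℝ × EuclideanSpace ℝ (Fin n)} (hz : 0 ≤ z.1) : dt H z = fderiv ℝ H z (1, 0) := by
  rw [dt, fderivWithin_futureHalf_eq hH hz]

theorem box_eq {H : ℝ × EuclideanSpace ℝ (Fin n) → ℝ} (hH : ContDiffOn ℝ 2 H (futureHalf n))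
    {z : ℝ × EuclideanSpace ℝ (Fin n)} (hz : 0 < z.1) :
    box H z = fderiv ℝ (fderiv ℝ H) z (1, 0) (1, 0)
      - ∑ i, fderiv ℝ (fderiv ℝ H) z (spaceDir i) (spaceDir i) := by
  have h1 : fderiv ℝ (dt H) z (1, 0) = _ := fderiv_fderivWithin_apply hH hz (1, 0) (1, 0)
  have h2 : ∀ i, fderiv ℝ (dx H i) z (spaceDir i) = _ := fun i =>
    fderiv_fderivWithin_apply hH hz (spaceDir i) (spaceDir i)
  simp only [box, h1, h2]

/-- The function `u` and its velocity vanish outside the light cone `‖x‖ ≤ t + R₀`. -/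
structure SupportedInCone (R₀ : ℝ) (u : ℝ × EuclideanSpace ℝ (Fin n) → ℝ) : Prop where
  eq_zero : ∀ t, 0 ≤ t → ∀ x, t + R₀ < ‖x‖ → u (t, x) = 0
  dt_eq_zero : ∀ t, 0 ≤ t → ∀ x, t + R₀ < ‖x‖ → dt u (t, x) = 0

theorem dt_eq_zero_of_eq_zero {u : ℝ × EuclideanSpace ℝ (Fin n) → ℝ} {R₀ : ℝ}
    (h : ∀ t, 0 ≤ t → ∀ x, t + R₀ < ‖x‖ → u (t, x) = 0) {t : ℝ} (ht : 0 < t)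
    {x : EuclideanSpace ℝ (Fin n)} (hx : t + R₀ < ‖x‖) : dt u (t, x) = 0 := by
  rw [← fderiv_apply_time (z := (t, x)) ht]
  have hx' : t < ‖x‖ - R₀ := by linarith
  obtain ⟨b, htb, hbx⟩ := exists_between hx'
  rw [fderiv_eq_zero_of_lt_dist (F := u) (a := 0) (b := b) (c := 0) (ρ := b + R₀) ?_ ⟨ht, htb⟩]
  · simp
  · simpa using by linarith
  · intro r hr y hy
    rw [dist_zero_right] at hy
    exact h r hr.1.le y (by linarith [hr.2])

variable {u H : ℝ × EuclideanSpace ℝ (Fin n) → ℝ} {κ p R₀ t : ℝ}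

theorem box_bracket {z : ℝ × EuclideanSpace ℝ (Fin n)} (hu : ContDiffOn ℝ 2 u (futureHalf n))
    (hH : ContDiffOn ℝ 2 H (futureHalf n)) (hz : 0 < z.1) :
    fderiv ℝ (fun z => dt u z * H z - u z * dt H z) z (1, 0)
      - ∑ i, fderiv ℝ (fun z => dx u i z * H z - u z * dx H i z) z (spaceDir i) =
    box u z * H z - u z * box H z := by
  have hut := (contDiffOn_differentiableAt (contDiffOn_dt hu) hz).hasFDerivAt
  have hux := fun i => (contDiffOn_differentiableAt (contDiffOn_dx hu i) hz).hasFDerivAt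
  have hHt := (contDiffOn_differentiableAt (contDiffOn_dt hH) hz).hasFDerivAt
  have hHx := fun i => (contDiffOn_differentiableAt (contDiffOn_dx hH i) hz).hasFDerivAt
  have huz := (contDiffOn_differentiableAt
    ((hu.mono Ioi_prod_subset_futureHalf).of_le (by norm_num)) hz).hasFDerivAt
  have hHz := (contDiffOn_differentiableAt
    ((hH.mono Ioi_prod_subset_futureHalf).of_le (by norm_num)) hz).hasFDerivAt
  have h1 : HasFDerivAt (fun z => dt u z * H z - u z * dt H z) _ z :=
    (hut.mul hHz).sub (huz.mul hHt)
  have h2 : ∀ i, HasFDerivAt (fun z => dx u i z * H z - u z * dx H i z) _ z :=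
    fun i => ((hux i).mul hHz).sub (huz.mul (hHx i))
  rw [h1.fderiv]
  simp only [(h2 _).fderiv, _root_.sub_apply, _root_.add_apply, _root_.smul_apply, smul_eq_mul,
    fderiv_apply_time (u := u) hz, fderiv_apply_time (u := H) hz,
    fderiv_apply_space (u := u) hz, fderiv_apply_space (u := H) hz, box]
  have e : ∑ i, (dx u i z * dx H i z + H z * fderiv ℝ (dx u i) z (spaceDir i)
      - (u z * fderiv ℝ (dx H i) z (spaceDir i) + dx H i z * dx u i z)) =
      H z * ∑ i, fderiv ℝ (dx u i) z (spaceDir i) - u z * ∑ i, fderiv ℝ (dx H i) z (spaceDir i) := by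
    rw [Finset.mul_sum, Finset.mul_sum, ← Finset.sum_sub_distrib]
    refine Finset.sum_congr rfl fun i _ => ?_
    ring
  rw [e]
  ring

theorem continuousOn_source (hp : 1 < p) (hu : ContDiffOn ℝ 2 u (futureHalf n)) :
    ContinuousOn (fun z : ℝ × EuclideanSpace ℝ (Fin n) => (1 + z.1) ^ (-κ) * |u z| ^ p)
      (futureHalf n) := by
  refine ContinuousOn.mul (ContinuousOn.rpow_const (by fun_prop) fun z hz => Or.inl ?_)
    (ContinuousOn.rpow_const hu.continuousOn.abs fun z _ => Or.inr (by linarith))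
  have : (0 : ℝ) ≤ z.1 := hz.1
  positivity

theorem continuousOn_integral_slice {F : ℝ × EuclideanSpace ℝ (Fin n) → ℝ} {ρ : ℝ}
    (hF : ContinuousOn F (futureHalf n)) (h0 : ∀ s ∈ Icc 0 t, ∀ x, ρ < ‖x‖ → F (s, x) = 0) :
    ContinuousOn (fun s => ∫ x, F (s, x)) (Icc 0 t) := by
  refine continuousOn_integral_of_compact_support (isCompact_closedBall 0 ρ)
    (f := fun s x => F (s, x)) (hF.mono (prod_mono Icc_subset_Ici_self Subset.rfl)) ?_
  intro s x hs hx
  exact h0 s hs x (by simpa using hx)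

/-- Testing with a solution `H` of the backward free wave equation which vanishes at time `t`. -/
theorem duality_identity (hp : 1 < p) (hu : IsWaveSolution κ p u) (hc : SupportedInCone R₀ u)
    (hH : ContDiff ℝ 2 H) (ht : 0 < t)
    (hbox : ∀ s x, 0 < s → s < t → ‖x‖ ≤ s + R₀ → box H (s, x) = 0)
    (hHt : ∀ x, H (t, x) = 0) :
    ∫ x, u (t, x) * -fderiv ℝ H (t, x) (1, 0) =
      (∫ x, (dt u (0, x) * H (0, x) - u (0, x) * fderiv ℝ H (0, x) (1, 0)))
        + ∫ s in (0 : ℝ)..t, ∫ x, (1 + s) ^ (-κ) * |u (s, x)| ^ p * H (s, x) := by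
  have hu2 := hu.contDiffOn
  have hH2 : ContDiffOn ℝ 2 H (futureHalf n) := hH.contDiffOn
  have hH1 : ContDiff ℝ 1 H := hH.of_le (by norm_num)
  set F : ℝ × EuclideanSpace ℝ (Fin n) → ℝ := fun z => dt u z * H z - u z * dt H z with hF
  set G : ℝ × EuclideanSpace ℝ (Fin n) → ℝ :=
    fun z => (1 + z.1) ^ (-κ) * |u z| ^ p * H z with hG
  have hFcont : ContinuousOn F (futureHalf n) :=
    ((continuousOn_dt hu2).mul hH2.continuousOn).sub (hu2.continuousOn.mul (continuousOn_dt hH2))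
  have huC1 : ContDiffOn ℝ 1 u (Ioi (0 : ℝ) ×ˢ univ) :=
    (hu2.mono Ioi_prod_subset_futureHalf).of_le (by norm_num)
  have hFC : ContDiffOn ℝ 1 F (Ioi (0 : ℝ) ×ˢ univ) :=
    ((contDiffOn_dt hu2).mul hH1.contDiffOn).sub (huC1.mul (contDiffOn_dt hH2))
  have hF0 : ∀ s ∈ Icc 0 t, ∀ x, t + R₀ < ‖x‖ → F (s, x) = 0 := by
    intro s hs x hx
    simp [hF, hc.eq_zero s hs.1 x (by linarith [hs.2]),
      hc.dt_eq_zero s hs.1 x (by linarith [hs.2])]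
  have hGcont : ContinuousOn G (futureHalf n) :=
    (continuousOn_source hp hu2).mul hH2.continuousOn
  have hG0 : ∀ s ∈ Icc 0 t, ∀ x, t + R₀ < ‖x‖ → G (s, x) = 0 := by
    intro s hs x hx
    simp [hG, hc.eq_zero s hs.1 x (by linarith [hs.2]), Real.zero_rpow (by linarith : p ≠ 0)]
  have hder : ∀ s ∈ Ioo 0 t, HasDerivAt (fun s => ∫ x, F (s, x)) (∫ x, G (s, x)) s := by
    intro s hs
    have h1 := hasDerivAt_integral_slice volume hFC le_rfl hs (c := 0) (ρ := t + R₀)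
      fun r hr x hx => hF0 r (Ioo_subset_Icc_self hr) x (by simpa using hx)
    convert h1 using 1
    set Φ : Fin n → ℝ × EuclideanSpace ℝ (Fin n) → ℝ :=
      fun i z => dx u i z * H z - u z * dx H i z with hΦ
    have hΦC : ∀ i, ContDiffOn ℝ 1 (Φ i) (Ioi (0 : ℝ) ×ˢ univ) := fun i =>
      ((contDiffOn_dx hu2 i).mul hH1.contDiffOn).sub (huC1.mul (contDiffOn_dx hH2 i))
    have hΦ0 : ∀ i, ∀ r ∈ Ioo 0 t, ∀ x, t + R₀ < dist x 0 → Φ i (r, x) = 0 := by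
      intro i r hr x hx
      have h2 : dx u i (r, x) = 0 := by
        rw [← fderiv_apply_space (z := (r, x)) hr.1,
          fderiv_eq_zero_of_lt_dist (F := u) (c := 0) (ρ := t + R₀) (a := 0) (b := t) ?_ hr hx]
        · simp
        · intro s hs y hy
          exact hc.eq_zero s hs.1.le y (by rw [dist_zero_right] at hy; linarith [hs.2])
      simp [hΦ, h2, hc.eq_zero r hr.1.le x (by rw [dist_zero_right] at hx; linarith [hr.2])]
    have hΦint : ∀ i, Integrable fun x => fderiv ℝ (Φ i) (s, x) (spaceDir i) := fun i =>
      integrable_slice volume (fderiv_apply_contDiffOn (m' := 0) (hΦC i) (by simp) _).continuousOn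
        hs.1 fun x hx => by rw [fderiv_eq_zero_of_lt_dist (hΦ0 i) hs hx]; simp
    have hFint : Integrable fun x => fderiv ℝ F (s, x) (1, 0) :=
      integrable_slice volume (fderiv_apply_contDiffOn (m' := 0) hFC (by simp) _).continuousOn
        hs.1 (c := 0) (ρ := t + R₀) fun x hx => by
          rw [fderiv_eq_zero_of_lt_dist (fun r hr y hy => hF0 r (Ioo_subset_Icc_self hr) y
            (by simpa using hy)) hs hx]
          simp
    have hdiv : ∀ i, ∫ x, fderiv ℝ (Φ i) (s, x) (spaceDir i) = 0 := fun i =>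
      integral_fderiv_space_eq_zero volume (hΦC i) hs.1 (hΦ0 i s hs) _
    have hsum : ∫ x, fderiv ℝ F (s, x) (1, 0) =
        ∫ x, (fderiv ℝ F (s, x) (1, 0) - ∑ i, fderiv ℝ (Φ i) (s, x) (spaceDir i)) := by
      rw [integral_sub hFint (integrable_finsetSum _ fun i _ => hΦint i),
        integral_finsetSum _ fun i _ => hΦint i]
      simp [hdiv]
    rw [hsum]
    refine integral_congr_ae (Eventually.of_forall fun x => ?_)
    have h3 := box_bracket (z := (s, x)) hu2 hH2 hs.1
    simp only [hF, hΦ, hG] at h3 ⊢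
    rw [h3, hu.equation (s, x) hs.1]
    rcases le_or_gt ‖x‖ (s + R₀) with hx | hx
    · rw [hbox s x hs.1 hs.2 hx, mul_zero, sub_zero]
    · rw [hc.eq_zero s hs.1.le x hx, zero_mul, sub_zero]
  have hFTC := intervalIntegral.integral_eq_sub_of_hasDerivAt_of_le ht.le
    (continuousOn_integral_slice hFcont hF0) hder
    (by
      refine ContinuousOn.intervalIntegrable ?_
      rw [uIcc_of_le ht.le]
      exact continuousOn_integral_slice hGcont hG0)
  have e1 : ∫ x, F (t, x) = ∫ x, u (t, x) * -fderiv ℝ H (t, x) (1, 0) := by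
    refine integral_congr_ae (Eventually.of_forall fun x => ?_)
    simp [hF, hHt, dt_eq_fderiv hH1 (z := (t, x)) ht.le]
  have e2 : ∫ x, F (0, x) =
      ∫ x, (dt u (0, x) * H (0, x) - u (0, x) * fderiv ℝ H (0, x) (1, 0)) := by
    refine integral_congr_ae (Eventually.of_forall fun x => ?_)
    simp [hF, dt_eq_fderiv hH1 (z := (0, x)) le_rfl]
  rw [← e1, ← e2, hFTC]
  ring

end Duality

/-! ### Conformal solutions of the free wave equation -/

section Kernel

/-- A globally smooth function that agrees with `y ^ (-m)` for `y ≥ 1`. -/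
noncomputable def cutPow (m y : ℝ) : ℝ := Real.smoothTransition (2 * y - 1) * y ^ (-m)

theorem cutPow_of_one_le {m y : ℝ} (hy : 1 ≤ y) : cutPow m y = y ^ (-m) := by
  rw [cutPow, Real.smoothTransition.one_of_one_le (by linarith), one_mul]

theorem contDiff_cutPow (m : ℝ) : ContDiff ℝ 2 (cutPow m) := by
  rw [contDiff_iff_contDiffAt]
  intro y
  rcases lt_or_ge y (1 / 2) with hy | hy
  · refine (contDiffAt_const (c := (0 : ℝ))).congr_of_eventuallyEq ?_
    filter_upwards [gt_mem_nhds hy] with x hx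
    rw [cutPow, Real.smoothTransition.zero_of_nonpos (by linarith), zero_mul]
  · refine ContDiffAt.mul ?_ (Real.contDiffAt_rpow_const_of_ne (by linarith))
    exact Real.smoothTransition.contDiff.contDiffAt.comp y (by fun_prop)

theorem deriv_cutPow {m y : ℝ} (hy : 1 < y) : deriv (cutPow m) y = -m * y ^ (-m - 1) := by
  have h : cutPow m =ᶠ[𝓝 y] fun y => y ^ (-m) := by
    filter_upwards [lt_mem_nhds hy] with x hx
    exact cutPow_of_one_le hx.le
  rw [h.deriv_eq]
  exact (Real.hasDerivAt_rpow_const (Or.inl (by linarith))).deriv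

theorem deriv_deriv_cutPow {m y : ℝ} (hy : 1 < y) :
    deriv (deriv (cutPow m)) y = m * (m + 1) * y ^ (-m - 2) := by
  have h : deriv (cutPow m) =ᶠ[𝓝 y] fun y => -m * y ^ (-m - 1) := by
    filter_upwards [lt_mem_nhds hy] with x hx
    exact deriv_cutPow hx
  rw [h.deriv_eq, ((Real.hasDerivAt_rpow_const (x := y) (p := -m - 1)
    (Or.inl (by linarith))).const_mul (-m)).deriv]
  rw [show -m - 1 - 1 = -m - 2 by ring]
  ring

variable {n : ℕ}

theorem fderiv_comp_lorentz {θ : ℝ → ℝ} (hθ : ContDiff ℝ 1 θ) (r : ℝ)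
    (c : EuclideanSpace ℝ (Fin n)) (z w : ℝ × EuclideanSpace ℝ (Fin n)) :
    fderiv ℝ (fun z => θ (lorentz r c z)) z w =
      deriv θ (lorentz r c z) * fderiv ℝ (lorentz r c) z w := by
  have h := (hθ.differentiable one_ne_zero (lorentz r c z)).hasDerivAt.comp_hasFDerivAt z
    ((contDiff_lorentz (m := 1)).differentiable one_ne_zero z).hasFDerivAt
  have h' : HasFDerivAt (fun z => θ (lorentz r c z)) _ z := h
  rw [h'.fderiv]
  simp

theorem fderiv_fderiv_comp_lorentz {θ : ℝ → ℝ} (hθ : ContDiff ℝ 2 θ) (r : ℝ)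
    (c : EuclideanSpace ℝ (Fin n)) (z w : ℝ × EuclideanSpace ℝ (Fin n)) :
    fderiv ℝ (fderiv ℝ (fun z => θ (lorentz r c z))) z w w =
      deriv (deriv θ) (lorentz r c z) * (fderiv ℝ (lorentz r c) z w) ^ 2
        + deriv θ (lorentz r c z) * (2 * w.1 ^ 2 - 2 * ‖w.2‖ ^ 2) := by
  have hC : ContDiff ℝ 2 fun z => θ (lorentz r c z) := hθ.comp contDiff_lorentz
  have h1 : fderiv ℝ (fun y => fderiv ℝ (fun z => θ (lorentz r c z)) y w) z w =
      fderiv ℝ (fderiv ℝ (fun z => θ (lorentz r c z))) z w w := by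
    rw [fderiv_clm_apply ((hC.fderiv_right (m := 1) (by norm_num)).differentiable one_ne_zero z)
      (differentiableAt_const w)]
    simp
  rw [← h1]
  have hθ1 : ContDiff ℝ 1 (deriv θ) := by
    have : ContDiff ℝ (1 + 1) θ := by simpa [one_add_one_eq_two] using hθ
    exact (contDiff_succ_iff_deriv.1 this).2.2
  have h2 : (fun y => fderiv ℝ (fun z => θ (lorentz r c z)) y w) =
      (fun y => deriv θ (lorentz r c y)) *
        fun y => -2 * (r - y.1) * w.1 - 2 * inner ℝ (y.2 - c) w.2 := by
    funext y
    rw [fderiv_comp_lorentz (hθ.of_le (by norm_num)), fderiv_lorentz]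
    rfl
  have h3 : HasFDerivAt (fun y : ℝ × EuclideanSpace ℝ (Fin n) =>
      -2 * (r - y.1) * w.1 - 2 * inner ℝ (y.2 - c) w.2)
      ((2 * w.1) • ContinuousLinearMap.fst ℝ ℝ (EuclideanSpace ℝ (Fin n)) -
        (2 : ℝ) • (innerSL ℝ w.2).comp (ContinuousLinearMap.snd ℝ ℝ _)) z := by
    have e : (fun y : ℝ × EuclideanSpace ℝ (Fin n) =>
        -2 * (r - y.1) * w.1 - 2 * inner ℝ (y.2 - c) w.2) = fun y =>
        ((2 * w.1) • ContinuousLinearMap.fst ℝ ℝ (EuclideanSpace ℝ (Fin n)) -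
        (2 : ℝ) • (innerSL ℝ w.2).comp (ContinuousLinearMap.snd ℝ ℝ _)) y
        + (2 * inner ℝ c w.2 - 2 * r * w.1) := by
      funext y
      simp [inner_sub_left, real_inner_comm]
      ring
    rw [e]
    exact (ContinuousLinearMap.hasFDerivAt _).add_const _
  have h4 : HasFDerivAt (fun y => deriv θ (lorentz r c y))
      (fderiv ℝ (fun y => deriv θ (lorentz r c y)) z) z :=
    ((hθ1.comp (contDiff_lorentz (r := r) (c := c) (m := 1))).differentiable
      one_ne_zero z).hasFDerivAt
  have h5 : fderiv ℝ (fun y => deriv θ (lorentz r c y)) z w =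
      deriv (deriv θ) (lorentz r c z) * fderiv ℝ (lorentz r c) z w :=
    fderiv_comp_lorentz hθ1 r c z w
  rw [h2, (h4.mul h3).fderiv]
  simp only [_root_.add_apply, _root_.smul_apply, smul_eq_mul, h5,
    _root_.sub_apply, ContinuousLinearMap.comp_apply, ContinuousLinearMap.coe_fst',
    ContinuousLinearMap.coe_snd', innerSL_apply_apply, real_inner_self_eq_norm_sq]
  rw [fderiv_lorentz]
  ring

theorem box_comp_lorentz {θ : ℝ → ℝ} (hθ : ContDiff ℝ 2 θ) {r : ℝ}
    {c : EuclideanSpace ℝ (Fin n)} {z : ℝ × EuclideanSpace ℝ (Fin n)} (hz : 0 < z.1) :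
    box (fun z => θ (lorentz r c z)) z =
      4 * lorentz r c z * deriv (deriv θ) (lorentz r c z)
        + 2 * (n + 1) * deriv θ (lorentz r c z) := by
  have hC : ContDiff ℝ 2 fun z => θ (lorentz r c z) := hθ.comp contDiff_lorentz
  rw [box_eq hC.contDiffOn hz]
  simp only [fderiv_fderiv_comp_lorentz hθ, fderiv_lorentz, spaceDir, inner_zero_right,
    EuclideanSpace.inner_single_right]
  have e : ∑ i, (deriv (deriv θ) (lorentz r c z) * (-2 * (r - z.1) * 0
      - 2 * (1 * (starRingEnd ℝ) ((z.2 - c) i))) ^ 2 + deriv θ (lorentz r c z) *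
      (2 * 0 ^ 2 - 2 * ‖(EuclideanSpace.single i 1 : EuclideanSpace ℝ (Fin n))‖ ^ 2)) =
      4 * deriv (deriv θ) (lorentz r c z) * ‖z.2 - c‖ ^ 2 - 2 * n * deriv θ (lorentz r c z) := by
    rw [EuclideanSpace.real_norm_sq_eq, Finset.mul_sum]
    rw [Finset.sum_add_distrib]
    congr 1
    · refine Finset.sum_congr rfl fun i _ => ?_
      simp
      ring
    · simp
      ring
  rw [e]
  simp only [norm_zero]
  unfold lorentz
  ring

/-- The conformally invariant solution `((r - t)² - ‖x‖²) ^ (-m)` of the free wave equation,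
`m = (n - 1) / 2`, modified away from the region `(r - t)² - ‖x‖² ≥ 1` to be smooth. -/
noncomputable def conformalKernel (m r : ℝ) (z : ℝ × EuclideanSpace ℝ (Fin n)) : ℝ :=
  cutPow m (lorentz r 0 z)

theorem contDiff_conformalKernel (m r : ℝ) :
    ContDiff ℝ 2 (conformalKernel (n := n) m r) :=
  (contDiff_cutPow m).comp contDiff_lorentz

theorem box_conformalKernel {m r : ℝ} (hm : m = ((n : ℝ) - 1) / 2)
    {z : ℝ × EuclideanSpace ℝ (Fin n)} (hz : 0 < z.1) (hl : 1 < lorentz r 0 z) :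
    box (conformalKernel m r) z = 0 := by
  have h := box_comp_lorentz (contDiff_cutPow m) (r := r) (c := 0) hz
  refine h.trans ?_
  rw [deriv_cutPow hl, deriv_deriv_cutPow hl]
  have e : lorentz r 0 z ^ (-m - 1) = lorentz r 0 z * lorentz r 0 z ^ (-m - 2) := by
    rw [← Real.rpow_one_add' (by linarith)]
    · congr 1
      ring
    · rw [hm]
      intro h
      have : (0 : ℝ) ≤ n := n.cast_nonneg
      linarith
  rw [e, hm]
  ring

theorem fderiv_conformalKernel_time {m r : ℝ} {z : ℝ × EuclideanSpace ℝ (Fin n)}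
    (hl : 1 < lorentz r 0 z) : fderiv ℝ (conformalKernel m r) z (1, 0) =
      2 * m * (r - z.1) * lorentz r 0 z ^ (-m - 1) := by
  have h := fderiv_comp_lorentz ((contDiff_cutPow m).of_le (by norm_num)) r 0 z (1, 0)
  refine h.trans ?_
  rw [deriv_cutPow hl, fderiv_lorentz]
  simp
  ring

/-- The odd reflection across time `t` of the conformal solution with singularity at time `-τ`:
a solution of the free wave equation that vanishes at time `t`. -/
noncomputable def reflectedKernel (m t τ : ℝ) (z : ℝ × EuclideanSpace ℝ (Fin n)) : ℝ :=
  1 / 2 * (conformalKernel m (-τ) z - conformalKernel m (2 * t + τ) z)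

theorem contDiff_reflectedKernel (m t τ : ℝ) :
    ContDiff ℝ 2 (reflectedKernel (n := n) m t τ) :=
  contDiff_const.mul ((contDiff_conformalKernel m _).sub (contDiff_conformalKernel m _))

theorem reflectedKernel_self (m t τ : ℝ) (x : EuclideanSpace ℝ (Fin n)) :
    reflectedKernel m t τ (t, x) = 0 := by
  have : lorentz (-τ) 0 (t, x) = lorentz (2 * t + τ) 0 (t, x) := by
    simp only [lorentz]
    ring
  simp [reflectedKernel, conformalKernel, this]

variable {R₀ τ s t m : ℝ} {x : EuclideanSpace ℝ (Fin n)}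

theorem one_lt_lorentz_neg (hR : 0 ≤ R₀) (hτ : R₀ + 2 ≤ τ) (hs : 0 ≤ s) (hx : ‖x‖ ≤ s + R₀) :
    1 < lorentz (-τ) 0 (s, x) := by
  simp only [lorentz, sub_zero]
  nlinarith [norm_nonneg x]

theorem one_lt_lorentz_reflect (hR : 0 ≤ R₀) (hτ : R₀ + 2 ≤ τ) (hs : 0 ≤ s) (hst : s ≤ t)
    (hx : ‖x‖ ≤ s + R₀) : 1 < lorentz (2 * t + τ) 0 (s, x) := by
  simp only [lorentz, sub_zero]
  nlinarith [norm_nonneg x]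

theorem fderiv_reflectedKernel_apply (w z : ℝ × EuclideanSpace ℝ (Fin n)) :
    fderiv ℝ (reflectedKernel m t τ) z w = 1 / 2 * (fderiv ℝ (conformalKernel m (-τ)) z w
      - fderiv ℝ (conformalKernel m (2 * t + τ)) z w) := by
  have h1 := ((contDiff_conformalKernel (n := n) m (-τ)).differentiable two_ne_zero z).hasFDerivAt
  have h2 := ((contDiff_conformalKernel (n := n) m (2 * t + τ)).differentiable
    two_ne_zero z).hasFDerivAt
  have h3 : HasFDerivAt (reflectedKernel m t τ) _ z := (h1.sub h2).const_mul (1 / 2)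
  rw [h3.fderiv]
  simp

theorem fderiv_reflectedKernel_eq (hR : 0 ≤ R₀) (hτ : R₀ + 2 ≤ τ) (ht : 0 ≤ t)
    (hx : ‖x‖ ≤ t + R₀) : -fderiv ℝ (reflectedKernel m t τ) (t, x) (1, 0) =
      2 * m * (t + τ) * ((t + τ) ^ 2 - ‖x‖ ^ 2) ^ (-m - 1) := by
  rw [fderiv_reflectedKernel_apply, fderiv_conformalKernel_time (one_lt_lorentz_neg hR hτ ht hx),
    fderiv_conformalKernel_time (one_lt_lorentz_reflect hR hτ ht le_rfl hx)]
  have e1 : lorentz (-τ) 0 (t, x) = (t + τ) ^ 2 - ‖x‖ ^ 2 := by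
    simp only [lorentz, sub_zero]
    ring
  have e2 : lorentz (2 * t + τ) 0 (t, x) = (t + τ) ^ 2 - ‖x‖ ^ 2 := by
    simp only [lorentz, sub_zero]
    ring
  rw [e1, e2]
  ring

theorem fderiv_reflectedKernel_zero_nonpos (hm : 0 ≤ m) (hR : 0 ≤ R₀) (hτ : R₀ + 2 ≤ τ)
    (ht : 0 ≤ t) (hx : ‖x‖ ≤ R₀) : fderiv ℝ (reflectedKernel m t τ) (0, x) (1, 0) ≤ 0 := by
  have h1 := one_lt_lorentz_neg (s := 0) (x := x) hR hτ le_rfl (by linarith)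
  have h2 := one_lt_lorentz_reflect (s := 0) (t := t) (x := x) hR hτ le_rfl ht (by linarith)
  rw [fderiv_reflectedKernel_apply, fderiv_conformalKernel_time h1, fderiv_conformalKernel_time h2]
  have h3 : 0 ≤ 2 * m * τ * lorentz (-τ) 0 (0, x) ^ (-m - 1) := by
    have : 0 ≤ τ := by linarith
    positivity
  have h4 : 0 ≤ 2 * m * (2 * t + τ) * lorentz (2 * t + τ) 0 (0, x) ^ (-m - 1) := by
    have : 0 ≤ τ := by linarith
    positivity
  simp only [sub_zero]
  linarith

theorem box_reflectedKernel (hm : m = ((n : ℝ) - 1) / 2) (hR : 0 ≤ R₀) (hτ : R₀ + 2 ≤ τ)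
    (hs : 0 < s) (hst : s ≤ t) (hx : ‖x‖ ≤ s + R₀) : box (reflectedKernel m t τ) (s, x) = 0 := by
  have h1 := box_conformalKernel hm (z := (s, x)) hs (one_lt_lorentz_neg hR hτ hs.le hx)
  have h2 := box_conformalKernel hm (z := (s, x)) hs (one_lt_lorentz_reflect hR hτ hs.le hst hx)
  rw [box_eq (contDiff_conformalKernel m _).contDiffOn (z := (s, x)) hs] at h1 h2
  rw [box_eq (contDiff_reflectedKernel m t τ).contDiffOn (z := (s, x)) hs]
  have e : fderiv ℝ (reflectedKernel (n := n) m t τ) = (1 / 2 : ℝ) •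
      (fderiv ℝ (conformalKernel m (-τ)) - fderiv ℝ (conformalKernel m (2 * t + τ))) := by
    funext z
    ext w
    · simp [fderiv_reflectedKernel_apply]
    · simp [fderiv_reflectedKernel_apply]
  have hd : ∀ r, DifferentiableAt ℝ (fderiv ℝ (conformalKernel (n := n) m r)) (s, x) := fun r =>
    ((contDiff_conformalKernel m r).fderiv_right (m := 1) (by norm_num)).differentiable
      one_ne_zero _
  rw [e, (((hd _).hasFDerivAt.sub (hd _).hasFDerivAt).const_smul (1 / 2 : ℝ)).fderiv]
  simp only [_root_.smul_apply, _root_.sub_apply, smul_eq_mul, ← Finset.mul_sum,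
    Finset.sum_sub_distrib]
  linarith

/-- For fixed `t` and `s` the kernel is smallest on the axis `x = 0`. -/
theorem le_reflectedKernel (hm : 1 ≤ 2 * m) (hR : 0 ≤ R₀) (hτ : R₀ + 2 ≤ τ) (hs : 0 ≤ s)
    (hst : s ≤ t) (hx : ‖x‖ ≤ s + R₀) :
    (s + τ) ^ (-(2 * m)) * ((t - s) / (2 * t - s + τ)) ≤ reflectedKernel m t τ (s, x) := by
  have h1 := one_lt_lorentz_neg (x := x) hR hτ hs hx
  have h2 := one_lt_lorentz_reflect (x := x) hR hτ hs hst hx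
  rw [reflectedKernel, conformalKernel, conformalKernel, cutPow_of_one_le h1.le,
    cutPow_of_one_le h2.le]
  set a : ℝ := s + τ with ha
  set a' : ℝ := 2 * t - s + τ with ha'
  have e1 : lorentz (-τ) 0 (s, x) = a ^ 2 - ‖x‖ ^ 2 := by
    simp only [lorentz, sub_zero, ha]
    ring
  have e2 : lorentz (2 * t + τ) 0 (s, x) = a' ^ 2 - ‖x‖ ^ 2 := by
    simp only [lorentz, sub_zero, ha']
    ring
  rw [e1] at h1 ⊢
  rw [e2] at h2 ⊢
  have ha0 : 0 < a := by linarith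
  have haa : a ≤ a' := by linarith
  have ha'0 : 0 < a' := by linarith
  set A : ℝ := a ^ 2 - ‖x‖ ^ 2 with hA
  set A' : ℝ := a' ^ 2 - ‖x‖ ^ 2 with hA'
  have hA0 : 0 < A := by linarith
  have hA'0 : 0 < A' := by linarith
  have hm0 : 0 ≤ m := by linarith
  -- the ratio of the two terms is controlled by its value on the axis
  have hratio : A'⁻¹ ^ m ≤ A⁻¹ ^ m * (a / a') := by
    have h3 : A / A' ≤ (a / a') ^ 2 := by
      rw [div_pow, div_le_div_iff₀ hA'0 (by positivity)]
      have : a ^ 2 ≤ a' ^ 2 := by gcongr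
      nlinarith [sq_nonneg ‖x‖]
    have h4 : (A / A') ^ m ≤ a / a' := by
      calc (A / A') ^ m ≤ ((a / a') ^ 2) ^ m := by gcongr
        _ = (a / a') ^ (2 * m) := by
          rw [← Real.rpow_natCast, ← Real.rpow_mul (by positivity)]
          norm_num
        _ ≤ (a / a') ^ (1 : ℝ) :=
          Real.rpow_le_rpow_of_exponent_ge (by positivity) ((div_le_one ha'0).2 haa) hm
        _ = a / a' := Real.rpow_one _
    calc A'⁻¹ ^ m = A⁻¹ ^ m * (A / A') ^ m := by
          rw [← Real.mul_rpow (by positivity) (by positivity)]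
          congr 1
          field_simp
      _ ≤ _ := by gcongr
  have hA2 : a ^ (-(2 * m)) ≤ A ^ (-m) := by
    have : a ^ (-(2 * m)) = (a ^ 2) ^ (-m) := by
      rw [← Real.rpow_natCast, ← Real.rpow_mul ha0.le]
      congr 1
      push_cast
      ring
    rw [this]
    refine Real.rpow_le_rpow_of_nonpos hA0 ?_ (by linarith)
    nlinarith [sq_nonneg ‖x‖]
  have e3 : (t - s) / a' = 1 / 2 * (1 - a / a') := by
    field_simp
    rw [ha, ha']
    ring
  have h5 : 0 ≤ 1 - a / a' := by
    have := (div_le_one ha'0).2 haa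
    linarith
  calc a ^ (-(2 * m)) * ((t - s) / a') ≤ A ^ (-m) * ((t - s) / a') := by
        rw [e3]
        gcongr
    _ = 1 / 2 * (A ^ (-m) - A ^ (-m) * (a / a')) := by rw [e3]; ring
    _ ≤ _ := by
      rw [Real.rpow_neg hA0.le, Real.rpow_neg hA'0.le, ← Real.inv_rpow hA0.le,
        ← Real.inv_rpow hA'0.le]
      linarith

end Kernel

/-! ### Estimates for powers, dyadic sums and radial integrals -/

theorem rpow_le_of_comparable {a b K : ℝ} (e : ℝ) (ha : 0 < a) (hb : 0 < b) (hK : 1 ≤ K)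
    (hab : a ≤ K * b) (hba : b ≤ K * a) : b ^ e ≤ K ^ |e| * a ^ e := by
  have hK0 : 0 < K := by linarith
  rcases le_or_gt 0 e with he | he
  · rw [abs_of_nonneg he, ← Real.mul_rpow hK0.le ha.le]
    gcongr
  · rw [abs_of_neg he, Real.rpow_neg hK0.le, ← Real.inv_rpow hK0.le,
      ← Real.mul_rpow (by positivity) ha.le]
    refine Real.rpow_le_rpow_of_nonpos (by positivity) ?_ he.le
    rw [inv_mul_le_iff₀ hK0]
    exact hab

/-- Dyadic version of `∫₀^∞ y ^ (γ - 1) (D + y) ^ (-(γ + δ)) dy = C D ^ (-δ)`. -/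
theorem sum_two_pow_le {γ δ : ℝ} (hγ : 0 < γ) (hδ : 0 < δ) : ∃ C : ℝ, 0 < C ∧ ∀ D : ℝ, 0 < D →
    ∀ J : ℕ, ∑ j ∈ Finset.range J, ((2 : ℝ) ^ j) ^ γ * (D + 2 ^ j) ^ (-(γ + δ)) ≤ C * D ^ (-δ) := by
  set ε : ℝ := min γ δ with hε
  have hε0 : 0 < ε := lt_min hγ hδ
  set r : ℝ := (2 : ℝ) ^ ε with hr
  have hr1 : 1 < r := Real.one_lt_rpow (by norm_num) hε0
  have hr0 : 0 < r := by linarith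
  refine ⟨4 * (r / (r - 1)), mul_pos (by norm_num) (div_pos hr0 (by linarith)), ?_⟩
  intro D hD J
  set D' : ℝ := D ^ ε with hD'
  have hD'0 : 0 < D' := by positivity
  -- the sum is dominated by a telescoping one
  set Ψ : ℕ → ℝ := fun j => r ^ j / (D' + r ^ j) with hΨ
  have hterm : ∀ j : ℕ, ((2 : ℝ) ^ j) ^ γ * (D + 2 ^ j) ^ (-(γ + δ)) ≤
      4 * (r / (r - 1)) * D ^ (-δ) * (Ψ (j + 1) - Ψ j) := by
    intro j
    set y : ℝ := (2 : ℝ) ^ j with hy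
    have hy0 : 0 < y := by positivity
    set y' : ℝ := r ^ j with hy'
    have hy'0 : 0 < y' := by positivity
    have hyy : y ^ ε = y' := by
      rw [hy, hy', hr, ← Real.rpow_natCast, ← Real.rpow_natCast, ← Real.rpow_mul (by norm_num),
        ← Real.rpow_mul (by norm_num), mul_comm]
    have hDy : 0 < D + y := by positivity
    have h1 : y ^ γ * (D + y) ^ (-(γ + δ)) = D ^ (-δ) * ((y / (D + y)) ^ γ * (D / (D + y)) ^ δ) := by
      rw [Real.div_rpow hy0.le hDy.le, Real.div_rpow hD.le hDy.le, Real.rpow_neg hDy.le,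
        Real.rpow_neg hD.le, Real.rpow_add hDy]
      have := Real.rpow_pos_of_pos hD δ
      field_simp
    have h2 : (y / (D + y)) ^ γ * (D / (D + y)) ^ δ ≤ (y / (D + y)) ^ ε * (D / (D + y)) ^ ε := by
      refine mul_le_mul ?_ ?_ (by positivity) (by positivity)
      · exact Real.rpow_le_rpow_of_exponent_ge (by positivity)
          ((div_le_one hDy).2 (by linarith)) (min_le_left _ _)
      · exact Real.rpow_le_rpow_of_exponent_ge (by positivity)
          ((div_le_one hDy).2 (by linarith)) (min_le_right _ _)
    have h3 : (y / (D + y)) ^ ε * (D / (D + y)) ^ ε = y' * D' / ((D + y) ^ ε) ^ 2 := by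
      rw [Real.div_rpow hy0.le hDy.le, Real.div_rpow hD.le hDy.le, hyy, ← hD']
      field_simp
    have h4 : (D' + y') / 2 ≤ (D + y) ^ ε := by
      have h5 : D' ≤ (D + y) ^ ε := Real.rpow_le_rpow hD.le (by linarith) hε0.le
      have h6 : y' ≤ (D + y) ^ ε := hyy ▸ Real.rpow_le_rpow hy0.le (by linarith) hε0.le
      linarith
    have h5 : y' * D' / ((D + y) ^ ε) ^ 2 ≤ y' * D' / ((D' + y') / 2) ^ 2 := by gcongr
    have h6 : Ψ (j + 1) - Ψ j = (r - 1) * (y' * D') / ((D' + r * y') * (D' + y')) := by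
      simp only [hΨ, pow_succ, ← hy']
      field_simp
      ring
    have h7 : (r - 1) * (y' * D') / (r * (D' + y') * (D' + y')) ≤ Ψ (j + 1) - Ψ j := by
      rw [h6]
      have : 0 < r - 1 := by linarith
      gcongr
      nlinarith
    have h8 : y' * D' / ((D' + y') / 2) ^ 2 =
        4 * (r / (r - 1)) * ((r - 1) * (y' * D') / (r * (D' + y') * (D' + y'))) := by
      have : r - 1 ≠ 0 := by linarith
      field_simp
      norm_num
    have h9 : 0 < r / (r - 1) := div_pos hr0 (by linarith)
    rw [h1]
    calc D ^ (-δ) * ((y / (D + y)) ^ γ * (D / (D + y)) ^ δ)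
        ≤ D ^ (-δ) * (4 * (r / (r - 1)) * (Ψ (j + 1) - Ψ j)) := by
          refine mul_le_mul_of_nonneg_left ?_ (by positivity)
          exact (h2.trans (h3.le.trans (h5.trans h8.le))).trans (by gcongr)
      _ = _ := by ring
  refine (Finset.sum_le_sum fun j _ => hterm j).trans ?_
  rw [← Finset.mul_sum, Finset.sum_range_sub]
  have h1 : Ψ J ≤ 1 := (div_le_one (by positivity)).2 (by linarith)
  have h0 : 0 ≤ Ψ 0 := by positivity
  have h9 : 0 < r / (r - 1) := div_pos hr0 (by linarith)
  calc 4 * (r / (r - 1)) * D ^ (-δ) * (Ψ J - Ψ 0) ≤ 4 * (r / (r - 1)) * D ^ (-δ) * 1 := by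
        gcongr
        linarith
    _ = _ := mul_one _

section Ball

variable {n : ℕ}

theorem setIntegral_closedBall_radial_le (hn : 1 ≤ n) {φ : ℝ → ℝ} (hφ : ContinuousOn φ (Ici 1))
    (hφ0 : ∀ y, 1 ≤ y → 0 ≤ φ y) {ρ : ℝ} (hρ : 0 ≤ ρ) :
    ∫ x in Metric.closedBall (0 : EuclideanSpace ℝ (Fin n)) ρ, φ (ρ + 1 - ‖x‖) ≤
      n * volume.real (Metric.ball (0 : EuclideanSpace ℝ (Fin n)) 1) *
        ((ρ + 1) ^ ((n : ℝ) - 1) * ∫ y in (1 : ℝ)..ρ + 1, φ y) := by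
  have : Nonempty (Fin n) := ⟨⟨0, hn⟩⟩
  set f : ℝ → ℝ := (Iic ρ).indicator fun r => φ (ρ + 1 - r) with hf
  have h1 : ∫ x in Metric.closedBall (0 : EuclideanSpace ℝ (Fin n)) ρ, φ (ρ + 1 - ‖x‖) =
      ∫ x : EuclideanSpace ℝ (Fin n), f ‖x‖ := by
    rw [← integral_indicator measurableSet_closedBall]
    refine integral_congr_ae (Eventually.of_forall fun x => ?_)
    simp only [hf, indicator, mem_Iic, Metric.mem_closedBall, dist_zero_right]
  have h2 : ∫ y in Ioi (0 : ℝ), y ^ (n - 1) • f y =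
      ∫ y in (0 : ℝ)..ρ, y ^ (n - 1) * φ (ρ + 1 - y) := by
    rw [intervalIntegral.integral_of_le hρ, ← Ioi_inter_Iic,
      ← setIntegral_indicator measurableSet_Iic]
    refine setIntegral_congr_fun measurableSet_Ioi fun y _ => ?_
    simp only [hf, indicator, smul_eq_mul]
    split_ifs <;> simp
  rw [h1, integral_fun_norm_addHaar, finrank_euclideanSpace, Fintype.card_fin, h2, nsmul_eq_mul,
    smul_eq_mul, ← mul_assoc]
  refine mul_le_mul_of_nonneg_left ?_ (by positivity)
  have hc : ContinuousOn (fun y => φ (ρ + 1 - y)) (uIcc 0 ρ) := by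
    rw [uIcc_of_le hρ]
    refine hφ.comp (by fun_prop) fun y hy => ?_
    simp only [mem_Ici]
    linarith [hy.2]
  have h3 : ∫ y in (0 : ℝ)..ρ, φ (ρ + 1 - y) = ∫ y in (1 : ℝ)..ρ + 1, φ y := by
    rw [intervalIntegral.integral_comp_sub_left]
    simp
  rw [← h3, ← intervalIntegral.integral_const_mul]
  refine intervalIntegral.integral_mono_on hρ ?_ ?_ fun y hy => ?_
  · exact (ContinuousOn.mul (by fun_prop) hc).intervalIntegrable
  · exact (ContinuousOn.mul (by fun_prop) hc).intervalIntegrable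
  · refine mul_le_mul_of_nonneg_right ?_ (hφ0 _ (by linarith [hy.2]))
    have : (n : ℝ) - 1 = ((n - 1 : ℕ) : ℝ) := by
      rw [Nat.cast_sub hn]
      simp
    rw [this, Real.rpow_natCast]
    have := hy.1
    gcongr
    linarith [hy.2]

theorem ContinuousOn.memLp_closedBall {f : EuclideanSpace ℝ (Fin n) → ℝ}
    {c : EuclideanSpace ℝ (Fin n)} {ρ : ℝ} (hf : ContinuousOn f (Metric.closedBall c ρ))
    (q : ENNReal) : MemLp f q (volume.restrict (Metric.closedBall c ρ)) := by
  obtain ⟨C, hC⟩ := (isCompact_closedBall c ρ).exists_bound_of_continuousOn hf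
  have : IsFiniteMeasure (volume.restrict (Metric.closedBall c ρ)) :=
    ⟨by rw [Measure.restrict_apply_univ]; exact measure_closedBall_lt_top⟩
  exact MemLp.of_bound (hf.aestronglyMeasurable measurableSet_closedBall) C
    ((ae_restrict_iff' measurableSet_closedBall).2 (Eventually.of_forall hC))

theorem rpow_setIntegral_mul_le {p ρ : ℝ} (hp : 1 < p) {f w : EuclideanSpace ℝ (Fin n) → ℝ}
    (hf : ContinuousOn f (Metric.closedBall 0 ρ)) (hw : ContinuousOn w (Metric.closedBall 0 ρ))
    (hw0 : ∀ x ∈ Metric.closedBall 0 ρ, 0 ≤ w x) :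
    (∫ x in Metric.closedBall 0 ρ, |f x| * w x) ^ p ≤
      (∫ x in Metric.closedBall 0 ρ, |f x| ^ p) *
        (∫ x in Metric.closedBall 0 ρ, w x ^ (p / (p - 1))) ^ (p - 1) := by
  have hp1 : 0 < p - 1 := by linarith
  have hw0' : 0 ≤ᵐ[volume.restrict (Metric.closedBall 0 ρ)] w :=
    (ae_restrict_iff' measurableSet_closedBall).2 (Eventually.of_forall hw0)
  have h := integral_mul_le_Lp_mul_Lq_of_nonneg (μ := volume.restrict (Metric.closedBall 0 ρ))
    (Real.HolderConjugate.conjExponent hp) (f := fun x => |f x|) (g := w)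
    (Eventually.of_forall fun x => abs_nonneg _) hw0'
    (hf.abs.memLp_closedBall _) (hw.memLp_closedBall _)
  have hI : 0 ≤ ∫ x in Metric.closedBall 0 ρ, |f x| ^ p := integral_nonneg fun x => by positivity
  have hW : 0 ≤ ∫ x in Metric.closedBall 0 ρ, w x ^ (p / (p - 1)) :=
    integral_nonneg_of_ae (hw0'.mono fun x hx => Real.rpow_nonneg hx _)
  have hl : 0 ≤ ∫ x in Metric.closedBall 0 ρ, |f x| * w x :=
    integral_nonneg_of_ae (hw0'.mono fun x hx => mul_nonneg (abs_nonneg _) hx)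
  refine (Real.rpow_le_rpow hl h (by linarith)).trans_eq ?_
  rw [Real.conjExponent, Real.mul_rpow (by positivity) (by positivity), ← Real.rpow_mul hI,
    ← Real.rpow_mul hW, one_div_mul_cancel (by linarith), Real.rpow_one]
  congr 2
  field_simp

end Ball

/-! ### The basic inequality obtained from a test function -/

section Testing

variable {n : ℕ} {u H : ℝ × EuclideanSpace ℝ (Fin n) → ℝ} {κ p R₀ t : ℝ}

/-- The total source `∫ (1 + s) ^ (-κ) |u(s, x)| ^ p dx` at time `s`. -/
noncomputable def sourceMass (κ p : ℝ) (u : ℝ × EuclideanSpace ℝ (Fin n) → ℝ) (s : ℝ) : ℝ :=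
  ∫ x, (1 + s) ^ (-κ) * |u (s, x)| ^ p

theorem sourceMass_nonneg {s : ℝ} (hs : 0 ≤ s) : 0 ≤ sourceMass κ p u s :=
  integral_nonneg fun x => by positivity

theorem continuous_slice_of_nonneg {F : ℝ × EuclideanSpace ℝ (Fin n) → ℝ}
    (hF : ContinuousOn F (futureHalf n)) {s : ℝ} (hs : 0 ≤ s) : Continuous fun x => F (s, x) := by
  rw [← continuousOn_univ]
  exact hF.comp (by fun_prop) fun x _ => ⟨hs, mem_univ _⟩

theorem integrable_slice_of_nonneg {F : ℝ × EuclideanSpace ℝ (Fin n) → ℝ}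
    (hF : ContinuousOn F (futureHalf n)) {s ρ : ℝ} (hs : 0 ≤ s)
    (h0 : ∀ x, ρ < ‖x‖ → F (s, x) = 0) : Integrable fun x => F (s, x) :=
  (continuous_slice_of_nonneg hF hs).integrable_of_hasCompactSupport
    (hasCompactSupport_of_forall_lt_dist (c := 0) (ρ := ρ) fun x hx => h0 x (by simpa using hx))

theorem continuousOn_sourceMass (hp : 1 < p) (hu : ContDiffOn ℝ 2 u (futureHalf n))
    (hc : SupportedInCone R₀ u) : ContinuousOn (sourceMass κ p u) (Ici 0) := by
  intro s hs
  have h := continuousOn_integral_slice (t := s + 1) (ρ := s + 1 + R₀)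
    (continuousOn_source (κ := κ) hp hu) (fun r hr x hx => by
      simp [hc.eq_zero r hr.1 x (by linarith [hr.2]), Real.zero_rpow (by linarith : p ≠ 0)])
  refine (h s ⟨hs, by linarith⟩).mono_of_mem_nhdsWithin ?_
  rw [mem_nhdsWithin]
  exact ⟨Iio (s + 1), isOpen_Iio, by simp, fun x hx => ⟨hx.2, hx.1.le⟩⟩

/-- A backward free wave `H` that vanishes at time `t` and is bounded below by `a` at time `0` and
by `b(s)` at time `s` controls the source by the pairing of `u(t)` with `-∂ₜH(t)`. -/
theorem le_integral_mul_neg_fderiv (hp : 1 < p) (hu : IsWaveSolution κ p u)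
    (hc : SupportedInCone R₀ u) (hu0 : ∀ x, 0 ≤ u (0, x)) (hu1 : ∀ x, 0 ≤ dt u (0, x))
    (hH : ContDiff ℝ 2 H) (ht : 0 < t)
    (hbox : ∀ s x, 0 < s → s < t → ‖x‖ ≤ s + R₀ → box H (s, x) = 0)
    (hHt : ∀ x, H (t, x) = 0) (hHn : ∀ s x, 0 ≤ s → s ≤ t → ‖x‖ ≤ s + R₀ → 0 ≤ H (s, x))
    {a : ℝ} (ha : ∀ x, ‖x‖ ≤ R₀ → a ≤ H (0, x))
    (hH' : ∀ x, ‖x‖ ≤ R₀ → fderiv ℝ H (0, x) (1, 0) ≤ 0) {t₁ : ℝ} (ht₁ : 0 ≤ t₁) (ht₁t : t₁ ≤ t)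
    {b : ℝ → ℝ} (hb : ContinuousOn b (Icc t₁ t))
    (hbH : ∀ s x, t₁ ≤ s → s ≤ t → ‖x‖ ≤ s + R₀ → b s ≤ H (s, x)) :
    a * (∫ x, dt u (0, x)) + ∫ s in t₁..t, b s * sourceMass κ p u s ≤
      ∫ x, u (t, x) * -fderiv ℝ H (t, x) (1, 0) := by
  have hu2 := hu.contDiffOn
  have hp0 : p ≠ 0 := by linarith
  rw [duality_identity hp hu hc hH ht hbox hHt]
  have hHc := hH.continuous
  have hH1c : Continuous fun z => fderiv ℝ H z (1, 0) :=
    (hH.continuous_fderiv two_ne_zero).clm_apply continuous_const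
  have hsrc := continuousOn_source (κ := κ) hp hu2
  have hGcont : ContinuousOn (fun z : ℝ × EuclideanSpace ℝ (Fin n) =>
      (1 + z.1) ^ (-κ) * |u z| ^ p * H z) (futureHalf n) := hsrc.mul hHc.continuousOn
  have hQc : ContinuousOn (fun s => ∫ x, (1 + s) ^ (-κ) * |u (s, x)| ^ p * H (s, x)) (Icc 0 t) :=
    continuousOn_integral_slice (ρ := t + R₀) hGcont fun s hs x hx => by
      simp [hc.eq_zero s hs.1 x (by linarith [hs.2]), Real.zero_rpow hp0]
  refine add_le_add ?_ ?_
  · rw [← integral_const_mul]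
    refine integral_mono ?_ ?_ fun x => ?_
    · exact (integrable_slice_of_nonneg (ρ := 0 + R₀) (continuousOn_dt hu2) le_rfl
        fun x hx => hc.dt_eq_zero 0 le_rfl x hx).const_mul a
    · refine integrable_slice_of_nonneg (ρ := 0 + R₀)
        (F := fun z => dt u z * H z - u z * fderiv ℝ H z (1, 0)) ?_ le_rfl fun x hx => ?_
      · exact ((continuousOn_dt hu2).mul hHc.continuousOn).sub
          (hu2.continuousOn.mul hH1c.continuousOn)
      · simp [hc.eq_zero 0 le_rfl x hx, hc.dt_eq_zero 0 le_rfl x hx]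
    · rcases le_or_gt ‖x‖ R₀ with hx | hx
      · have h1 := mul_le_mul_of_nonneg_left (ha x hx) (hu1 x)
        have h2 := mul_nonneg (hu0 x) (neg_nonneg.2 (hH' x hx))
        simp only
        linarith
      · have hx' : 0 + R₀ < ‖x‖ := by linarith
        simp [hc.eq_zero 0 le_rfl x hx', hc.dt_eq_zero 0 le_rfl x hx']
  · have hI1 : IntervalIntegrable (fun s => ∫ x, (1 + s) ^ (-κ) * |u (s, x)| ^ p * H (s, x))
        volume 0 t₁ := by
      refine (hQc.mono ?_).intervalIntegrable
      rw [uIcc_of_le ht₁]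
      exact Icc_subset_Icc_right ht₁t
    have hI2 : IntervalIntegrable (fun s => ∫ x, (1 + s) ^ (-κ) * |u (s, x)| ^ p * H (s, x))
        volume t₁ t := by
      refine (hQc.mono ?_).intervalIntegrable
      rw [uIcc_of_le ht₁t]
      exact Icc_subset_Icc_left ht₁
    rw [← intervalIntegral.integral_add_adjacent_intervals hI1 hI2]
    have h1 : 0 ≤ ∫ s in (0 : ℝ)..t₁, ∫ x, (1 + s) ^ (-κ) * |u (s, x)| ^ p * H (s, x) := by
      refine intervalIntegral.integral_nonneg ht₁ fun s hs => integral_nonneg fun x => ?_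
      have hs0 := hs.1
      rcases le_or_gt ‖x‖ (s + R₀) with hx | hx
      · have := hHn s x hs.1 (hs.2.trans ht₁t) hx
        simp only [Pi.zero_apply]
        positivity
      · simp [hc.eq_zero s hs.1 x hx, Real.zero_rpow hp0]
    have h2 : ∫ s in t₁..t, b s * sourceMass κ p u s ≤
        ∫ s in t₁..t, ∫ x, (1 + s) ^ (-κ) * |u (s, x)| ^ p * H (s, x) := by
      refine intervalIntegral.integral_mono_on ht₁t ?_ hI2 fun s hs => ?_
      · refine ContinuousOn.intervalIntegrable ?_
        rw [uIcc_of_le ht₁t]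
        exact hb.mul ((continuousOn_sourceMass hp hu2 hc).mono fun s hs => ht₁.trans hs.1)
      · have hs0 : 0 ≤ s := ht₁.trans hs.1
        rw [sourceMass, ← integral_const_mul]
        refine integral_mono ?_ ?_ fun x => ?_
        · refine (integrable_slice_of_nonneg (ρ := s + R₀) hsrc hs0 fun x hx => ?_).const_mul _
          simp [hc.eq_zero s hs0 x hx, Real.zero_rpow hp0]
        · refine integrable_slice_of_nonneg (ρ := s + R₀) hGcont hs0 fun x hx => ?_
          simp [hc.eq_zero s hs0 x hx, Real.zero_rpow hp0]
        · rcases le_or_gt ‖x‖ (s + R₀) with hx | hx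
          · have h3 : 0 ≤ (1 + s) ^ (-κ) * |u (s, x)| ^ p := by positivity
            have h4 := mul_le_mul_of_nonneg_left (hbH s x hs.1 hs.2 hx) h3
            simp only
            linarith
          · simp [hc.eq_zero s hs0 x hx, Real.zero_rpow hp0]
    linarith

/-- The inequality of `le_integral_mul_neg_fderiv` combined with Hölder's inequality on the support
of `u(t)`. -/
theorem rpow_le_sourceMass_mul (hp : 1 < p) (hu : IsWaveSolution κ p u)
    (hc : SupportedInCone R₀ u) (hu0 : ∀ x, 0 ≤ u (0, x)) (hu1 : ∀ x, 0 ≤ dt u (0, x))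
    (hH : ContDiff ℝ 2 H) (ht : 0 < t)
    (hbox : ∀ s x, 0 < s → s < t → ‖x‖ ≤ s + R₀ → box H (s, x) = 0)
    (hHt : ∀ x, H (t, x) = 0) (hHn : ∀ s x, 0 ≤ s → s ≤ t → ‖x‖ ≤ s + R₀ → 0 ≤ H (s, x))
    {a : ℝ} (ha0 : 0 ≤ a) (ha : ∀ x, ‖x‖ ≤ R₀ → a ≤ H (0, x))
    (hH' : ∀ x, ‖x‖ ≤ R₀ → fderiv ℝ H (0, x) (1, 0) ≤ 0) {t₁ : ℝ} (ht₁ : 0 ≤ t₁) (ht₁t : t₁ ≤ t)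
    {b : ℝ → ℝ} (hb : ContinuousOn b (Icc t₁ t)) (hb0 : ∀ s ∈ Icc t₁ t, 0 ≤ b s)
    (hbH : ∀ s x, t₁ ≤ s → s ≤ t → ‖x‖ ≤ s + R₀ → b s ≤ H (s, x))
    {w : EuclideanSpace ℝ (Fin n) → ℝ} (hw : ContinuousOn w (Metric.closedBall 0 (t + R₀)))
    (hw0 : ∀ x ∈ Metric.closedBall 0 (t + R₀), 0 ≤ w x)
    (hHw : ∀ x, ‖x‖ ≤ t + R₀ → |fderiv ℝ H (t, x) (1, 0)| ≤ w x) :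
    (a * (∫ x, dt u (0, x)) + ∫ s in t₁..t, b s * sourceMass κ p u s) ^ p ≤
      (1 + t) ^ κ * sourceMass κ p u t *
        (∫ x in Metric.closedBall (0 : EuclideanSpace ℝ (Fin n)) (t + R₀),
          w x ^ (p / (p - 1))) ^ (p - 1) := by
  have h1 := le_integral_mul_neg_fderiv hp hu hc hu0 hu1 hH ht hbox hHt hHn ha hH' ht₁ ht₁t hb hbH
  have hp0 : p ≠ 0 := by linarith
  have hut : Continuous fun x => u (t, x) := continuous_slice_of_nonneg hu.contDiffOn.continuousOn
    ht.le
  have h0 : 0 ≤ a * (∫ x, dt u (0, x)) + ∫ s in t₁..t, b s * sourceMass κ p u s := by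
    refine add_nonneg (mul_nonneg ha0 (integral_nonneg hu1)) ?_
    exact intervalIntegral.integral_nonneg ht₁t fun s hs =>
      mul_nonneg (hb0 s hs) (sourceMass_nonneg (ht₁.trans hs.1))
  have hH1c : Continuous fun x => fderiv ℝ H (t, x) (1, 0) :=
    ((hH.continuous_fderiv two_ne_zero).clm_apply continuous_const).comp (by fun_prop :
      Continuous fun x : EuclideanSpace ℝ (Fin n) => (t, x))
  have hK : IsCompact (Metric.closedBall (0 : EuclideanSpace ℝ (Fin n)) (t + R₀)) :=
    isCompact_closedBall _ _
  have h2 : ∫ x, u (t, x) * -fderiv ℝ H (t, x) (1, 0) ≤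
      ∫ x in Metric.closedBall 0 (t + R₀), |u (t, x)| * w x := by
    rw [← setIntegral_eq_integral_of_forall_compl_eq_zero
      (s := Metric.closedBall (0 : EuclideanSpace ℝ (Fin n)) (t + R₀)) fun x hx => ?_]
    · refine setIntegral_mono_on ?_ ?_ measurableSet_closedBall fun x hx => ?_
      · exact (hut.mul hH1c.neg).continuousOn.integrableOn_compact hK
      · exact (hut.abs.continuousOn.mul hw).integrableOn_compact hK
      · calc u (t, x) * -fderiv ℝ H (t, x) (1, 0)
            ≤ |u (t, x) * -fderiv ℝ H (t, x) (1, 0)| := le_abs_self _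
          _ = |u (t, x)| * |fderiv ℝ H (t, x) (1, 0)| := by rw [abs_mul, abs_neg]
          _ ≤ _ := by
            gcongr
            exact hHw x (by simpa using hx)
    · rw [hc.eq_zero t ht.le x (by simpa using hx), zero_mul]
  refine (Real.rpow_le_rpow h0 (h1.trans h2) (by linarith)).trans
    ((rpow_setIntegral_mul_le hp hut.continuousOn hw hw0).trans_eq ?_)
  congr 1
  rw [sourceMass, integral_const_mul, ← mul_assoc, ← Real.rpow_add (by linarith), add_neg_cancel,
    Real.rpow_zero, one_mul]
  refine setIntegral_eq_integral_of_forall_compl_eq_zero fun x hx => ?_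
  simp [hc.eq_zero t ht.le x (by simpa using hx), Real.zero_rpow hp0]

end Testing

/-! ### The Fujita range -/

section Fujita

variable {n : ℕ} {u : ℝ × EuclideanSpace ℝ (Fin n) → ℝ} {κ p R₀ : ℝ}

theorem comparable_add {t R : ℝ} (ht : 1 ≤ t) (hR : 0 ≤ R) : t + R ≤ (1 + R) * t := by
  nlinarith

theorem add_rpow_le {t R : ℝ} (e : ℝ) (ht : 1 ≤ t) (hR : 0 ≤ R) :
    (t + R) ^ e ≤ (1 + R) ^ |e| * t ^ e :=
  rpow_le_of_comparable e (by linarith) (by linarith) (by linarith) (by nlinarith)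
    (comparable_add ht hR)

/-- Testing with `t - s`, that is, following the mean `∫ u dx`, excludes global solutions in the
range `κ + n (p - 1) ≤ p + 1`. -/
theorem not_isWaveSolution_fujita (hn : 1 ≤ n) (hp : 1 < p) (hR : 0 ≤ R₀)
    (hu : IsWaveSolution κ p u) (hc : SupportedInCone R₀ u) (hu0 : ∀ x, 0 ≤ u (0, x))
    (hu1 : ∀ x, 0 ≤ dt u (0, x)) (hmass : 0 < ∫ x, dt u (0, x))
    (hκp : κ + n * (p - 1) ≤ p + 1) : False := by
  set m₁ : ℝ := ∫ x, dt u (0, x) with hm₁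
  set J : ℝ → ℝ := sourceMass κ p u with hJ
  have hp1 : 0 < p - 1 := by linarith
  set B : ℝ := n * volume.real (Metric.ball (0 : EuclideanSpace ℝ (Fin n)) 1) with hB
  have hB0 : 0 ≤ B := by positivity
  have hJ0 : ∀ s, 0 ≤ s → 0 ≤ J s := fun s hs => sourceMass_nonneg hs
  have hJc : ContinuousOn J (Ici 0) := continuousOn_sourceMass hp hu.contDiffOn hc
  -- the inequality for the mean
  have h1 : ∀ t, 3 ≤ t → (t * (m₁ + ∫ s in (3 : ℝ)..t, (1 - s / t) * (s * J s) / s)) ^ p ≤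
      (1 + t) ^ κ * J t * (B * (t + R₀ + 1) ^ (n : ℝ)) ^ (p - 1) := by
    intro t ht
    have ht0 : 0 < t := by linarith
    set H : ℝ × EuclideanSpace ℝ (Fin n) → ℝ := fun z => t - z.1 with hH
    have hH' : fderiv ℝ H = fun _ => -ContinuousLinearMap.fst ℝ ℝ (EuclideanSpace ℝ (Fin n)) :=
      funext fun z => (hasFDerivAt_fst.const_sub t).fderiv
    have hHC : ContDiff ℝ 2 H := contDiff_const.sub contDiff_fst
    have h := rpow_le_sourceMass_mul (a := t) (t₁ := 3) (b := fun s => t - s) (w := fun _ => 1)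
      hp hu hc hu0 hu1 hHC ht0
      (fun s x hs _ _ => by
        rw [box_eq hHC.contDiffOn (z := (s, x)) hs, hH']
        simp)
      (fun x => by simp [hH]) (fun s x _ hs _ => by simp [hH, hs]) ht0.le
      (fun x _ => by simp [hH]) (fun x _ => by simp [hH']) (by norm_num) ht (by fun_prop)
      (fun s hs => by linarith [hs.2]) (fun s x _ _ _ => le_rfl) continuousOn_const
      (fun _ _ => zero_le_one) (fun x _ => by simp [hH'])
    have e1 : t * (m₁ + ∫ s in (3 : ℝ)..t, (1 - s / t) * (s * J s) / s) =
        t * m₁ + ∫ s in (3 : ℝ)..t, (t - s) * J s := by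
      rw [mul_add, ← intervalIntegral.integral_const_mul]
      congr 1
      refine intervalIntegral.integral_congr fun s hs => ?_
      rw [uIcc_of_le ht] at hs
      have : s ≠ 0 := by linarith [hs.1]
      field_simp
    rw [e1]
    refine h.trans ?_
    refine mul_le_mul_of_nonneg_left ?_ (mul_nonneg (by positivity) (hJ0 t ht0.le))
    refine Real.rpow_le_rpow (integral_nonneg fun x => by positivity) ?_ hp1.le
    have h2 := setIntegral_closedBall_radial_le hn (φ := fun _ => (1 : ℝ)) continuousOn_const
      (fun _ _ => zero_le_one) (ρ := t + R₀) (by linarith)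
    simp only [Real.one_rpow]
    refine h2.trans ?_
    rw [← hB]
    refine mul_le_mul_of_nonneg_left ?_ hB0
    have h3 : 0 < t + R₀ + 1 := by linarith
    rw [intervalIntegral.integral_const, smul_eq_mul, mul_one, Real.rpow_sub_one h3.ne']
    rw [div_mul_eq_mul_div, div_le_iff₀ h3]
    refine mul_le_mul_of_nonneg_left (by linarith) (by positivity)
  -- powers of `1 + t` and `t + R₀ + 1` are comparable to powers of `t`
  obtain ⟨C, hC0, hC⟩ : ∃ C : ℝ, 0 < C ∧ ∀ t, 3 ≤ t →
      (m₁ + ∫ s in (3 : ℝ)..t, (1 - s / t) * (s * J s) / s) ^ p ≤ C * (t * J t) := by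
    refine ⟨(1 + 1) ^ |κ| * ((1 + (R₀ + 1)) ^ |(n : ℝ) * (p - 1)| * B ^ (p - 1)) + 1,
      by positivity, fun t ht => ?_⟩
    have ht0 : 0 < t := by linarith
    have h2 := h1 t ht
    have hM0 : 0 ≤ m₁ + ∫ s in (3 : ℝ)..t, (1 - s / t) * (s * J s) / s := by
      refine add_nonneg hmass.le (intervalIntegral.integral_nonneg ht fun s hs => ?_)
      have hs0 : 0 ≤ s := by linarith [hs.1]
      have : s / t ≤ 1 := (div_le_one ht0).2 hs.2
      exact div_nonneg (mul_nonneg (by linarith) (mul_nonneg hs0 (hJ0 s hs0))) hs0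
    rw [Real.mul_rpow ht0.le hM0, Real.mul_rpow hB0 (by positivity), ← Real.rpow_mul (by linarith)]
      at h2
    have h3 := add_rpow_le κ (by linarith : 1 ≤ t) zero_le_one
    have h4 := add_rpow_le (n * (p - 1)) (by linarith : 1 ≤ t) (by linarith : 0 ≤ R₀ + 1)
    have hJt := hJ0 t ht0.le
    set M := m₁ + ∫ s in (3 : ℝ)..t, (1 - s / t) * (s * J s) / s with hM
    set K₁ : ℝ := (1 + 1) ^ |κ| with hK₁
    set K₂ : ℝ := (1 + (R₀ + 1)) ^ |(n : ℝ) * (p - 1)| with hK₂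
    have hK₁0 : 0 < K₁ := by positivity
    have hK₂0 : 0 < K₂ := by positivity
    have h5 : t ^ κ * t ^ ((n : ℝ) * (p - 1)) ≤ t ^ p * t := by
      rw [← Real.rpow_add ht0, ← Real.rpow_add_one ht0.ne']
      exact Real.rpow_le_rpow_of_exponent_le (by linarith) hκp
    refine le_of_mul_le_mul_left ?_ (Real.rpow_pos_of_pos ht0 p)
    calc t ^ p * M ^ p ≤ (1 + t) ^ κ * J t *
          (B ^ (p - 1) * (t + R₀ + 1) ^ ((n : ℝ) * (p - 1))) := h2
      _ ≤ (K₁ * t ^ κ) * J t * (B ^ (p - 1) * (K₂ * t ^ ((n : ℝ) * (p - 1)))) := by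
        rw [add_comm 1 t, add_assoc t R₀ 1]
        gcongr
      _ = K₁ * (K₂ * B ^ (p - 1)) * J t * (t ^ κ * t ^ ((n : ℝ) * (p - 1))) := by ring
      _ ≤ K₁ * (K₂ * B ^ (p - 1)) * J t * (t ^ p * t) := by gcongr
      _ ≤ t ^ p * ((K₁ * (K₂ * B ^ (p - 1)) + 1) * (t * J t)) := by
        have : 0 ≤ t ^ p * (t * J t) := by positivity
        linarith
  have hMnn : ∀ t, 3 ≤ t → 0 ≤ ∫ s in (3 : ℝ)..t, (1 - s / t) * (s * J s) / s := by
    intro t ht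
    refine intervalIntegral.integral_nonneg ht fun s hs => ?_
    have hs0 : 0 ≤ s := by linarith [hs.1]
    have : s / t ≤ 1 := (div_le_one (by linarith)).2 hs.2
    exact div_nonneg (mul_nonneg (by linarith) (mul_nonneg hs0 (hJ0 s hs0))) hs0
  refine not_integral_inequality (i := fun s => s * J s) (t₀ := 3) (c := m₁ ^ p / C) (C := C)
    (p := p) (by norm_num) hp (by positivity)
    (continuousOn_id.mul (hJc.mono (Ici_subset_Ici.2 (by norm_num)))) (fun t ht => ?_)
    (fun t ht => ?_)
  · rw [div_le_iff₀ hC0, mul_comm]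
    refine le_trans ?_ (hC t ht)
    have := hMnn t ht
    gcongr
    linarith
  · have hlog : 1 ≤ Real.log t := by
      rw [Real.le_log_iff_exp_le (by linarith)]
      linarith [Real.exp_one_lt_d9]
    have h6 := hMnn t ht
    have h7 := hJ0 t (by linarith)
    refine le_trans (Real.rpow_le_rpow h6 (by linarith) (by linarith)) ((hC t ht).trans ?_)
    have h8 : 1 ≤ Real.log t ^ (p - 1) := Real.one_le_rpow hlog hp1.le
    have h9 : 0 ≤ t * J t := mul_nonneg (by linarith) h7
    refine mul_le_mul_of_nonneg_left ?_ hC0.le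
    nlinarith

end Fujita

/-! ### The Strauss range -/

section Strauss

variable {n : ℕ} {u : ℝ × EuclideanSpace ℝ (Fin n) → ℝ} {κ p R₀ : ℝ}

/-- The `L^{p'}` norm over the cone of a weight of size `K (t + R) ^ (-m) D ^ (-b)`, where
`D = t + R - ‖x‖` is the distance to the boundary of a slightly larger cone. -/
theorem setIntegral_cone_weight_le (hn : 1 ≤ n) (hp : 1 < p) (hR : 0 ≤ R₀) {m : ℝ}
    (hm : m = ((n : ℝ) - 1) / 2) (b : ℝ) {K : ℝ} (hK : 0 ≤ K) : ∃ C : ℝ, 0 < C ∧ ∀ t, 0 ≤ t →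
      (∫ x in Metric.closedBall (0 : EuclideanSpace ℝ (Fin n)) (t + R₀),
        (K * (t + R₀ + 1) ^ (-m) * (t + R₀ + 1 - ‖x‖) ^ (-b)) ^ (p / (p - 1))) ^ (p - 1) ≤
      C * ((t + R₀ + 1) ^ (m * (p - 2)) *
        (∫ y in (1 : ℝ)..t + R₀ + 1, y ^ (-(b * (p / (p - 1))))) ^ (p - 1)) := by
  have hp1 : 0 < p - 1 := by linarith
  set q : ℝ := p / (p - 1) with hq
  set B : ℝ := n * volume.real (Metric.ball (0 : EuclideanSpace ℝ (Fin n)) 1) with hB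
  have hB0 : 0 ≤ B := by positivity
  refine ⟨(K ^ q * B) ^ (p - 1) + 1, by positivity, fun t ht => ?_⟩
  set T : ℝ := t + R₀ + 1 with hT
  have hT1 : 1 ≤ T := by linarith
  have hT0 : 0 < T := by linarith
  have h1 := setIntegral_closedBall_radial_le hn (φ := fun y => y ^ (-(b * q)))
    (ContinuousOn.rpow_const continuousOn_id fun y hy => Or.inl (one_pos.trans_le hy).ne')
    (fun y hy => by positivity) (ρ := t + R₀) (by linarith)
  set L : ℝ := ∫ y in (1 : ℝ)..T, y ^ (-(b * q)) with hL
  have hL0 : 0 ≤ L := intervalIntegral.integral_nonneg hT1 fun y hy => by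
    have := hy.1
    positivity
  have e1 : ∫ x in Metric.closedBall (0 : EuclideanSpace ℝ (Fin n)) (t + R₀),
      (K * T ^ (-m) * (T - ‖x‖) ^ (-b)) ^ q =
      (K * T ^ (-m)) ^ q * ∫ x in Metric.closedBall (0 : EuclideanSpace ℝ (Fin n)) (t + R₀),
        (T - ‖x‖) ^ (-(b * q)) := by
    rw [← integral_const_mul]
    refine setIntegral_congr_fun measurableSet_closedBall fun x hx => ?_
    have hx' : ‖x‖ ≤ t + R₀ := by simpa using hx
    have hD : 0 ≤ T - ‖x‖ := by linarith
    rw [Real.mul_rpow (by positivity) (by positivity), ← Real.rpow_mul hD, neg_mul]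
  have hint : 0 ≤ ∫ x in Metric.closedBall (0 : EuclideanSpace ℝ (Fin n)) (t + R₀),
      (T - ‖x‖) ^ (-(b * q)) := by
    refine setIntegral_nonneg measurableSet_closedBall fun x hx => ?_
    have hx' : ‖x‖ ≤ t + R₀ := by simpa using hx
    have hD : 0 ≤ T - ‖x‖ := by linarith
    positivity
  rw [e1]
  have hqp : q * (p - 1) = p := by
    rw [hq]
    field_simp
  have e2 : ((T ^ (-m)) ^ q * T ^ ((n : ℝ) - 1)) ^ (p - 1) = T ^ (m * (p - 2)) := by
    rw [← Real.rpow_mul hT0.le, ← Real.rpow_add hT0, ← Real.rpow_mul hT0.le]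
    congr 1
    have : (n : ℝ) - 1 = 2 * m := by rw [hm]; ring
    rw [this, add_mul, mul_assoc, hqp]
    ring
  calc ((K * T ^ (-m)) ^ q * ∫ x in Metric.closedBall (0 : EuclideanSpace ℝ (Fin n)) (t + R₀),
        (T - ‖x‖) ^ (-(b * q))) ^ (p - 1)
      ≤ ((K * T ^ (-m)) ^ q * (B * (T ^ ((n : ℝ) - 1) * L))) ^ (p - 1) := by
        refine Real.rpow_le_rpow (by positivity) ?_ hp1.le
        exact mul_le_mul_of_nonneg_left h1 (by positivity)
    _ = ((K ^ q * B) * (((T ^ (-m)) ^ q * T ^ ((n : ℝ) - 1)) * L)) ^ (p - 1) := by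
      rw [Real.mul_rpow hK (by positivity)]
      congr 1
      ring
    _ = (K ^ q * B) ^ (p - 1) * (T ^ (m * (p - 2)) * L ^ (p - 1)) := by
      rw [Real.mul_rpow (by positivity) (by positivity), Real.mul_rpow (by positivity) hL0, e2]
    _ ≤ _ := by
      have : 0 ≤ T ^ (m * (p - 2)) * L ^ (p - 1) := by positivity
      linarith

/-- The powers of `t` collected from the source, from Hölder's inequality and from the dyadic
weights match when `(1 + t) ^ (-κ)` decays no faster than in the critical case. -/
theorem rpow_mul_rpow_le (hR : 0 ≤ R₀) {m q : ℝ} (hκ : κ + m * (p - 2) ≤ 1 - q) :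
    ∃ C : ℝ, 0 < C ∧ ∀ t, 1 ≤ t →
      (1 + t) ^ κ * (t + R₀ + 1) ^ (m * (p - 2)) ≤ C * t ^ (1 - q) := by
  refine ⟨(1 + 1) ^ |κ| * (1 + (R₀ + 1)) ^ |m * (p - 2)|, by positivity, fun t ht => ?_⟩
  have ht0 : 0 < t := by linarith
  have h3 := add_rpow_le κ ht zero_le_one
  have h4 := add_rpow_le (m * (p - 2)) ht (by linarith : 0 ≤ R₀ + 1)
  rw [add_comm 1 t, add_assoc t R₀ 1]
  calc (t + 1) ^ κ * (t + (R₀ + 1)) ^ (m * (p - 2))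
      ≤ ((1 + 1) ^ |κ| * t ^ κ) * ((1 + (R₀ + 1)) ^ |m * (p - 2)| * t ^ (m * (p - 2))) := by
        gcongr
    _ = (1 + 1) ^ |κ| * (1 + (R₀ + 1)) ^ |m * (p - 2)| * (t ^ κ * t ^ (m * (p - 2))) := by ring
    _ ≤ _ := by
      rw [← Real.rpow_add ht0]
      gcongr

/-- Size of `-∂ₜ` of the reflected kernel at the reflection time. -/
theorem neg_fderiv_reflectedKernel_le {m t τ : ℝ} {x : EuclideanSpace ℝ (Fin n)} (hm : 0 ≤ m)
    (hR : 0 ≤ R₀) (hτ : R₀ + 2 ≤ τ) (ht : 0 ≤ t) (hx : ‖x‖ ≤ t + R₀) :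
    0 ≤ -fderiv ℝ (reflectedKernel m t τ) (t, x) (1, 0) ∧
      -fderiv ℝ (reflectedKernel m t τ) (t, x) (1, 0) ≤
        2 * m * (t + R₀ + 1) ^ (-m) * (t + τ - ‖x‖) ^ (-(m + 1)) := by
  rw [fderiv_reflectedKernel_eq hR hτ ht hx]
  have hx0 := norm_nonneg x
  have hD : 0 < t + τ - ‖x‖ := by linarith
  have hS : 0 < t + τ := by linarith
  have hP : (t + τ - ‖x‖) * (t + τ) ≤ (t + τ) ^ 2 - ‖x‖ ^ 2 := by nlinarith
  have hP0 : 0 < (t + τ) ^ 2 - ‖x‖ ^ 2 := lt_of_lt_of_le (by positivity) hP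
  refine ⟨by positivity, ?_⟩
  have h1 : ((t + τ) ^ 2 - ‖x‖ ^ 2) ^ (-m - 1) ≤
      (t + τ - ‖x‖) ^ (-(m + 1)) * (t + τ) ^ (-m - 1) := by
    rw [neg_add', ← Real.mul_rpow hD.le hS.le]
    exact Real.rpow_le_rpow_of_nonpos (by positivity) hP (by linarith)
  have h2 : (t + τ) * (t + τ) ^ (-m - 1) = (t + τ) ^ (-m) := by
    rw [Real.rpow_sub_one hS.ne']
    field_simp
  have h3 : (t + τ) ^ (-m) ≤ (t + R₀ + 1) ^ (-m) :=
    Real.rpow_le_rpow_of_nonpos (by linarith) (by linarith) (by linarith)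
  calc 2 * m * (t + τ) * ((t + τ) ^ 2 - ‖x‖ ^ 2) ^ (-m - 1)
      ≤ 2 * m * (t + τ) * ((t + τ - ‖x‖) ^ (-(m + 1)) * (t + τ) ^ (-m - 1)) := by gcongr
    _ = 2 * m * ((t + τ) * (t + τ) ^ (-m - 1)) * (t + τ - ‖x‖) ^ (-(m + 1)) := by ring
    _ ≤ _ := by
      rw [h2]
      gcongr

theorem continuousOn_cone_weight (K T b : ℝ) {ρ : ℝ} (hρ : ρ < T) :
    ContinuousOn (fun x : EuclideanSpace ℝ (Fin n) => K * (T - ‖x‖) ^ (-b))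
      (Metric.closedBall 0 ρ) := by
  refine continuousOn_const.mul (ContinuousOn.rpow_const (by fun_prop) fun x hx => Or.inl ?_)
  have : ‖x‖ ≤ ρ := by simpa using hx
  linarith

/-- The test with a single conformal kernel bounds the source from below. -/
theorem exists_le_sourceMass (hn : 2 ≤ n) (hp : 1 < p) (hR : 0 ≤ R₀)
    (hu : IsWaveSolution κ p u) (hc : SupportedInCone R₀ u) (hu0 : ∀ x, 0 ≤ u (0, x))
    (hu1 : ∀ x, 0 ≤ dt u (0, x)) (hmass : 0 < ∫ x, dt u (0, x)) {m q : ℝ}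
    (hm : m = ((n : ℝ) - 1) / 2) (hκ : κ + m * (p - 2) ≤ 1 - q) :
    ∃ c : ℝ, 0 < c ∧ ∀ t, 2 ≤ t → c ≤ t ^ (1 - q) * sourceMass κ p u t := by
  have hp1 : 0 < p - 1 := by linarith
  have hn' : (2 : ℝ) ≤ n := by exact_mod_cast hn
  have hm0 : 1 ≤ 2 * m := by linarith
  have hm0' : 0 ≤ m := by linarith
  set τ : ℝ := R₀ + 2 with hτ
  have hτ0 : 0 < τ := by linarith
  set a : ℝ := τ ^ (-(2 * m)) * (1 / (2 + τ)) with ha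
  have ha0 : 0 < a := by positivity
  set m₁ : ℝ := ∫ x, dt u (0, x) with hm₁
  obtain ⟨C₁, hC₁, h1⟩ := setIntegral_cone_weight_le (n := n) (by omega) hp hR hm 1
    (K := 2 * m) (by positivity)
  obtain ⟨C₂, hC₂, h2⟩ := rpow_mul_rpow_le (κ := κ) (p := p) hR hκ
  -- `∫₁^∞ y ^ (-p / (p - 1)) dy = p - 1`
  have hLle : ∀ t, 2 ≤ t → (∫ y in (1 : ℝ)..t + R₀ + 1, y ^ (-(1 * (p / (p - 1))))) ≤ p - 1 := by
    intro t ht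
    have e : -(1 * (p / (p - 1))) + 1 = -(1 / (p - 1)) := by
      field_simp
      ring
    have hlt : -(1 * (p / (p - 1))) ≠ -1 := by
      intro h
      rw [h] at e
      have : 0 < 1 / (p - 1) := by positivity
      linarith
    rw [integral_rpow (Or.inr ⟨hlt, by
      rw [uIcc_of_le (by linarith)]
      intro h
      linarith [h.1]⟩), e, Real.one_rpow]
    have h3 : 0 ≤ (t + R₀ + 1) ^ (-(1 / (p - 1))) := by positivity
    rw [div_neg, ← neg_div, div_le_iff₀ (by positivity), mul_one_div_cancel hp1.ne']
    linarith
  refine ⟨(a * m₁) ^ p / (C₁ * C₂ * (p - 1) ^ (p - 1)), by positivity, fun t ht => ?_⟩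
  have ht0 : 0 < t := by linarith
  have hkey := rpow_le_sourceMass_mul (H := reflectedKernel m t τ) (a := a) (t₁ := t)
    (b := fun _ => 0) (w := fun x => 2 * m * (t + R₀ + 1) ^ (-m) * (t + R₀ + 1 - ‖x‖) ^ (-(1 : ℝ)))
    hp hu hc hu0 hu1 (contDiff_reflectedKernel m t τ) ht0
    (fun s x hs hst hx => box_reflectedKernel hm hR le_rfl hs hst.le hx)
    (reflectedKernel_self m t τ)
    (fun s x hs hst hx => le_trans (mul_nonneg (by positivity)
      (div_nonneg (by linarith) (by linarith))) (le_reflectedKernel hm0 hR le_rfl hs hst hx))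
    ha0.le
    (fun x hx => by
      refine le_trans ?_ (le_reflectedKernel hm0 hR le_rfl le_rfl ht0.le (by linarith))
      rw [ha, zero_add]
      refine mul_le_mul_of_nonneg_left ?_ (by positivity)
      rw [div_le_div_iff₀ (by linarith) (by linarith)]
      nlinarith)
    (fun x hx => fderiv_reflectedKernel_zero_nonpos hm0' hR le_rfl ht0.le hx) ht0.le le_rfl
    continuousOn_const (fun _ _ => le_rfl)
    (fun s x h1 h2 hx => le_trans (mul_nonneg (Real.rpow_nonneg (by linarith) _)
      (div_nonneg (by linarith) (by linarith))) (le_reflectedKernel hm0 hR le_rfl (by linarith) h2 hx))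
    (continuousOn_cone_weight _ _ _ (by linarith))
    (fun x hx => by
      have : ‖x‖ ≤ t + R₀ := by simpa using hx
      have : 0 ≤ t + R₀ + 1 - ‖x‖ := by linarith
      positivity)
    (fun x hx => by
      obtain ⟨h3, h4⟩ := neg_fderiv_reflectedKernel_le hm0' hR le_rfl ht0.le hx
      rw [← abs_neg, abs_of_nonneg h3]
      refine h4.trans (mul_le_mul_of_nonneg_left ?_ (by positivity))
      calc (t + (R₀ + 2) - ‖x‖) ^ (-(m + 1)) ≤ (t + (R₀ + 2) - ‖x‖) ^ (-(1 : ℝ)) :=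
            Real.rpow_le_rpow_of_exponent_le (by linarith) (by linarith)
        _ ≤ _ := Real.rpow_le_rpow_of_nonpos (by linarith) (by linarith) (by norm_num))
  rw [intervalIntegral.integral_same, add_zero] at hkey
  set J := sourceMass κ p u t with hJ
  have hJ0 : 0 ≤ J := sourceMass_nonneg ht0.le
  have hT0 : 0 < t + R₀ + 1 := by linarith
  have hL0 : 0 ≤ ∫ y in (1 : ℝ)..t + R₀ + 1, y ^ (-(1 * (p / (p - 1)))) :=
    intervalIntegral.integral_nonneg (by linarith) fun y hy => by
      have := hy.1
      positivity
  rw [div_le_iff₀ (by positivity)]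
  calc (a * m₁) ^ p ≤ _ := hkey
    _ ≤ (1 + t) ^ κ * J * (C₁ * ((t + R₀ + 1) ^ (m * (p - 2)) * (p - 1) ^ (p - 1))) := by
      refine mul_le_mul_of_nonneg_left ((h1 t ht0.le).trans ?_) (by positivity)
      gcongr
      exact hLle t ht
    _ = J * (C₁ * (p - 1) ^ (p - 1)) * ((1 + t) ^ κ * (t + R₀ + 1) ^ (m * (p - 2))) := by ring
    _ ≤ J * (C₁ * (p - 1) ^ (p - 1)) * (C₂ * t ^ (1 - q)) :=
      mul_le_mul_of_nonneg_left (h2 t (by linarith)) (by positivity)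
    _ = _ := by ring

end Strauss

/-! ### Dyadic superposition of reflected kernels -/

section Dyadic

variable {n : ℕ} {u : ℝ × EuclideanSpace ℝ (Fin n) → ℝ} {κ p R₀ : ℝ}

theorem fderiv_sum_mul {ι : Type*} (s : Finset ι) (c : ι → ℝ)
    {K : ι → ℝ × EuclideanSpace ℝ (Fin n) → ℝ} (hK : ∀ j, ContDiff ℝ 2 (K j)) :
    fderiv ℝ (fun z => ∑ j ∈ s, c j * K j z) = fun z => ∑ j ∈ s, c j • fderiv ℝ (K j) z := by
  funext z
  exact (HasFDerivAt.fun_sum fun j _ =>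
    ((hK j).differentiable two_ne_zero z).hasFDerivAt.const_mul (c j)).fderiv

theorem box_sum_mul {ι : Type*} (s : Finset ι) (c : ι → ℝ)
    {K : ι → ℝ × EuclideanSpace ℝ (Fin n) → ℝ} (hK : ∀ j, ContDiff ℝ 2 (K j))
    {z : ℝ × EuclideanSpace ℝ (Fin n)} (hz : 0 < z.1) :
    box (fun z => ∑ j ∈ s, c j * K j z) z = ∑ j ∈ s, c j * box (K j) z := by
  have hC : ContDiff ℝ 2 fun z => ∑ j ∈ s, c j * K j z :=
    ContDiff.sum fun j _ => contDiff_const.mul (hK j)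
  have h2 : fderiv ℝ (fun z => ∑ j ∈ s, c j • fderiv ℝ (K j) z) z =
      ∑ j ∈ s, c j • fderiv ℝ (fderiv ℝ (K j)) z :=
    (HasFDerivAt.fun_sum fun j _ => ((((hK j).fderiv_right (m := 1) (by norm_num)).differentiable
      one_ne_zero z).hasFDerivAt.const_smul (c j))).fderiv
  rw [box_eq hC.contDiffOn hz, fderiv_sum_mul s c hK, h2]
  simp only [box_eq (hK _).contDiffOn hz, _root_.sum_apply, _root_.smul_apply, smul_eq_mul,
    mul_sub, Finset.sum_sub_distrib, Finset.mul_sum]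
  rw [Finset.sum_comm (s := s)]

/-- A weighted superposition of reflected kernels with singularities at the times
`-(R₀ + 1 + 2 ^ j)`. The weights `2 ^ (j γ)` produce the decay `t ^ (-m) D ^ (γ - m - 1)` of the time
derivative at distance `D` from the boundary of the cone. -/
noncomputable def dyadicKernel (γ m R₀ t : ℝ) (N : ℕ) (z : ℝ × EuclideanSpace ℝ (Fin n)) : ℝ :=
  ∑ j ∈ Finset.range N, ((2 : ℝ) ^ j) ^ γ * reflectedKernel m t (R₀ + 1 + 2 ^ j) z

theorem add_two_le_shift (R₀ : ℝ) (j : ℕ) : R₀ + 2 ≤ R₀ + 1 + 2 ^ j := by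
  have : (1 : ℝ) ≤ 2 ^ j := one_le_pow₀ (by norm_num)
  linarith

theorem contDiff_dyadicKernel (γ m R₀ t : ℝ) (N : ℕ) :
    ContDiff ℝ 2 (dyadicKernel (n := n) γ m R₀ t N) :=
  ContDiff.sum fun _ _ => contDiff_const.mul (contDiff_reflectedKernel _ _ _)

theorem fderiv_dyadicKernel_apply (γ m R₀ t : ℝ) (N : ℕ) (z w : ℝ × EuclideanSpace ℝ (Fin n)) :
    fderiv ℝ (dyadicKernel γ m R₀ t N) z w =
      ∑ j ∈ Finset.range N, ((2 : ℝ) ^ j) ^ γ *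
        fderiv ℝ (reflectedKernel m t (R₀ + 1 + 2 ^ j)) z w := by
  have h := congrFun (fderiv_sum_mul (Finset.range N) (fun j => ((2 : ℝ) ^ j) ^ γ)
    (K := fun j => reflectedKernel (n := n) m t (R₀ + 1 + 2 ^ j))
    fun j => contDiff_reflectedKernel _ _ _) z
  have h' : fderiv ℝ (dyadicKernel γ m R₀ t N) z = _ := h
  rw [h']
  simp

theorem reflectedKernel_nonneg {m t τ s : ℝ} {x : EuclideanSpace ℝ (Fin n)} (hm : 1 ≤ 2 * m)
    (hR : 0 ≤ R₀) (hτ : R₀ + 2 ≤ τ) (hs : 0 ≤ s) (hst : s ≤ t) (hx : ‖x‖ ≤ s + R₀) :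
    0 ≤ reflectedKernel m t τ (s, x) :=
  (mul_nonneg (Real.rpow_nonneg (by linarith) _) (div_nonneg (by linarith) (by linarith))).trans
    (le_reflectedKernel hm hR hτ hs hst hx)

/-- Already the term with `2 ^ j ≤ s < 2 ^ (j + 1)` gives the lower bound needed. -/
theorem le_dyadicKernel {γ m s t : ℝ} {N : ℕ} {x : EuclideanSpace ℝ (Fin n)} (hγ : 0 ≤ γ)
    (hm : 1 ≤ 2 * m) (hR : 0 ≤ R₀) (hs : 1 ≤ s) (hst : s ≤ t) (hN : t < 2 ^ N)
    (hx : ‖x‖ ≤ s + R₀) :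
    (1 / 2) ^ γ * (3 + R₀) ^ (-(2 * m)) / (3 + R₀) * (s ^ (γ - 2 * m) * (1 - s / t)) ≤
      dyadicKernel γ m R₀ t N (s, x) := by
  obtain ⟨j, hj1, hj2⟩ := exists_nat_pow_near hs one_lt_two
  have hjN : j < N := by
    by_contra h
    have : (2 : ℝ) ^ N ≤ 2 ^ j := pow_le_pow_right₀ (by norm_num) (not_lt.1 h)
    linarith
  have hs0 : 0 < s := by linarith
  have ht0 : 0 < t := by linarith
  have hterm : ∀ i ∈ Finset.range N,
      0 ≤ ((2 : ℝ) ^ i) ^ γ * reflectedKernel m t (R₀ + 1 + 2 ^ i) (s, x) := fun i _ =>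
    mul_nonneg (by positivity)
      (reflectedKernel_nonneg hm hR (add_two_le_shift R₀ i) hs0.le hst hx)
  refine le_trans ?_ (Finset.single_le_sum hterm (Finset.mem_range.2 hjN))
  have h1 := le_reflectedKernel hm hR (add_two_le_shift R₀ j) hs0.le hst hx
  have h2 : (1 / 2 * s) ^ γ ≤ ((2 : ℝ) ^ j) ^ γ := by
    refine Real.rpow_le_rpow (by positivity) ?_ hγ
    rw [pow_succ] at hj2
    linarith
  have h3 : ((3 + R₀) * s) ^ (-(2 * m)) ≤ (s + (R₀ + 1 + 2 ^ j)) ^ (-(2 * m)) :=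
    Real.rpow_le_rpow_of_nonpos (by positivity) (by nlinarith) (by linarith)
  have h4 : (t - s) / ((3 + R₀) * t) ≤ (t - s) / (2 * t - s + (R₀ + 1 + 2 ^ j)) := by
    refine div_le_div_of_nonneg_left (by linarith) ?_ (by nlinarith)
    have : (0 : ℝ) < 2 ^ j := by positivity
    linarith
  have h5 : 0 ≤ (t - s) / ((3 + R₀) * t) := div_nonneg (by linarith) (by positivity)
  calc (1 / 2) ^ γ * (3 + R₀) ^ (-(2 * m)) / (3 + R₀) * (s ^ (γ - 2 * m) * (1 - s / t))
      = (1 / 2 * s) ^ γ * (((3 + R₀) * s) ^ (-(2 * m)) * ((t - s) / ((3 + R₀) * t))) := by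
        rw [Real.mul_rpow (by norm_num) hs0.le, Real.mul_rpow (by positivity) hs0.le, sub_eq_add_neg γ,
          Real.rpow_add hs0]
        field_simp
    _ ≤ ((2 : ℝ) ^ j) ^ γ * ((s + (R₀ + 1 + 2 ^ j)) ^ (-(2 * m)) *
          ((t - s) / (2 * t - s + (R₀ + 1 + 2 ^ j)))) := by
        gcongr
    _ ≤ _ := by gcongr

theorem log_add_le {t R : ℝ} (ht : 2 ≤ t) (hR : 0 ≤ R) :
    Real.log (t + R) ≤ (1 + Real.log (1 + R) / Real.log 2) * Real.log t := by
  have h2 : 0 < Real.log 2 := Real.log_pos (by norm_num)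
  have h3 : Real.log 2 ≤ Real.log t := Real.log_le_log (by norm_num) ht
  have h4 : 0 ≤ Real.log (1 + R) := Real.log_nonneg (by linarith)
  have h5 : Real.log (t + R) ≤ Real.log t + Real.log (1 + R) := by
    rw [← Real.log_mul (by linarith) (by linarith)]
    exact Real.log_le_log (by linarith) (by nlinarith)
  have h6 : Real.log (1 + R) ≤ Real.log (1 + R) / Real.log 2 * Real.log t := by
    rw [div_mul_eq_mul_div, le_div_iff₀ h2]
    gcongr
  linarith

/-- The critical nonlinear integral inequality: the test with the dyadic superposition. -/
theorem exists_integral_inequality (hn : 2 ≤ n) (hp : 1 < p) (hR : 0 ≤ R₀)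
    (hu : IsWaveSolution κ p u) (hc : SupportedInCone R₀ u) (hu0 : ∀ x, 0 ≤ u (0, x))
    (hu1 : ∀ x, 0 ≤ dt u (0, x)) {m : ℝ} (hm : m = ((n : ℝ) - 1) / 2)
    (hκ : κ + m * (p - 2) ≤ 1 - (m - 1 / p)) :
    ∃ C : ℝ, ∀ t, 2 ≤ t →
      (∫ s in (2 : ℝ)..t, (1 - s / t) * (s ^ (1 - (m - 1 / p)) * sourceMass κ p u s) / s) ^ p ≤
        C * (t ^ (1 - (m - 1 / p)) * sourceMass κ p u t * Real.log t ^ (p - 1)) := by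
  have hp0 : 0 < p := by linarith
  have hp1 : 0 < p - 1 := by linarith
  have hn' : (2 : ℝ) ≤ n := by exact_mod_cast hn
  have hm0 : 1 ≤ 2 * m := by linarith
  have hm0' : 0 ≤ m := by linarith
  set q : ℝ := m - 1 / p with hq
  -- `γ` is chosen so that the weight is `D ^ (-1 / p')`, just failing to be in `L^{p'}`
  set γ : ℝ := m + 1 / p with hγ
  have hγ0 : 0 < γ := by positivity
  have hδ0 : 0 < 1 - 1 / p := by
    rw [sub_pos, div_lt_one hp0]
    exact hp
  obtain ⟨Cs, hCs, hsum⟩ := sum_two_pow_le hγ0 hδ0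
  obtain ⟨C₁, hC₁, h1⟩ := setIntegral_cone_weight_le (n := n) (by omega) hp hR hm (1 - 1 / p)
    (K := 2 * m * Cs) (by positivity)
  obtain ⟨C₂, hC₂, h2⟩ := rpow_mul_rpow_le (κ := κ) (p := p) hR hκ
  set c : ℝ := (1 / 2) ^ γ * (3 + R₀) ^ (-(2 * m)) / (3 + R₀) with hc'
  have hc0 : 0 < c := by positivity
  set Cl : ℝ := 1 + Real.log (1 + (R₀ + 1)) / Real.log 2 with hCl
  have hCl0 : 0 < Cl := by
    have h3 : 0 < Real.log 2 := Real.log_pos (by norm_num)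
    have h4 : 0 ≤ Real.log (1 + (R₀ + 1)) := Real.log_nonneg (by linarith)
    positivity
  refine ⟨C₁ * C₂ * Cl ^ (p - 1) / c ^ p, fun t ht => ?_⟩
  have ht0 : 0 < t := by linarith
  obtain ⟨N, hN⟩ := pow_unbounded_of_one_lt t one_lt_two
  have hkey := rpow_le_sourceMass_mul (H := dyadicKernel γ m R₀ t N) (a := 0) (t₁ := 2)
    (b := fun s => c * (s ^ (γ - 2 * m) * (1 - s / t)))
    (w := fun x => 2 * m * Cs * (t + R₀ + 1) ^ (-m) * (t + R₀ + 1 - ‖x‖) ^ (-(1 - 1 / p)))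
    hp hu hc hu0 hu1 (contDiff_dyadicKernel γ m R₀ t N) ht0
    (fun s x hs hst hx => by
      refine (box_sum_mul (Finset.range N) (fun j => ((2 : ℝ) ^ j) ^ γ)
        (K := fun j => reflectedKernel m t (R₀ + 1 + 2 ^ j))
        (fun j => contDiff_reflectedKernel _ _ _) (z := (s, x)) hs).trans ?_
      refine Finset.sum_eq_zero fun j _ => ?_
      rw [box_reflectedKernel hm hR (add_two_le_shift R₀ j) hs hst.le hx, mul_zero])
    (fun x => by simp [dyadicKernel, reflectedKernel_self])
    (fun s x hs hst hx => Finset.sum_nonneg fun j _ => mul_nonneg (by positivity)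
      (reflectedKernel_nonneg hm0 hR (add_two_le_shift R₀ j) hs hst hx))
    le_rfl
    (fun x hx => Finset.sum_nonneg fun j _ => mul_nonneg (by positivity)
      (reflectedKernel_nonneg hm0 hR (add_two_le_shift R₀ j) le_rfl ht0.le (by linarith)))
    (fun x hx => by
      rw [fderiv_dyadicKernel_apply]
      refine Finset.sum_nonpos fun j _ => mul_nonpos_of_nonneg_of_nonpos (by positivity) ?_
      exact fderiv_reflectedKernel_zero_nonpos hm0' hR (add_two_le_shift R₀ j) ht0.le hx)
    (by norm_num) ht
    (by
      refine continuousOn_const.mul (ContinuousOn.mul (ContinuousOn.rpow_const continuousOn_id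
        fun s hs => Or.inl ?_) (by fun_prop))
      exact (two_pos.trans_le hs.1).ne')
    (fun s hs => by
      have : s / t ≤ 1 := (div_le_one ht0).2 hs.2
      have hs0 : 0 ≤ s := by linarith [hs.1]
      exact mul_nonneg hc0.le (mul_nonneg (by positivity) (by linarith)))
    (fun s x hs hst hx => le_dyadicKernel hγ0.le hm0 hR (by linarith) hst hN hx)
    (continuousOn_cone_weight _ _ _ (by linarith))
    (fun x hx => by
      have : ‖x‖ ≤ t + R₀ := by simpa using hx
      have : 0 ≤ t + R₀ + 1 - ‖x‖ := by linarith
      positivity)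
    (fun x hx => by
      have hb := fun j : ℕ =>
        neg_fderiv_reflectedKernel_le hm0' hR (add_two_le_shift R₀ j) ht0.le hx
      rw [fderiv_dyadicKernel_apply, ← abs_neg, ← Finset.sum_neg_distrib]
      simp only [← mul_neg]
      rw [abs_of_nonneg (Finset.sum_nonneg fun j _ => mul_nonneg (by positivity) (hb j).1)]
      calc ∑ j ∈ Finset.range N, ((2 : ℝ) ^ j) ^ γ *
            -fderiv ℝ (reflectedKernel m t (R₀ + 1 + 2 ^ j)) (t, x) (1, 0)
          ≤ ∑ j ∈ Finset.range N, 2 * m * (t + R₀ + 1) ^ (-m) *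
            (((2 : ℝ) ^ j) ^ γ * (t + R₀ + 1 - ‖x‖ + 2 ^ j) ^ (-(γ + (1 - 1 / p)))) := by
            refine Finset.sum_le_sum fun j _ => ?_
            have e1 : γ + (1 - 1 / p) = m + 1 := by rw [hγ]; ring
            have e2 : t + R₀ + 1 - ‖x‖ + 2 ^ j = t + (R₀ + 1 + 2 ^ j) - ‖x‖ := by ring
            rw [e1, e2]
            refine (mul_le_mul_of_nonneg_left (hb j).2 (by positivity)).trans_eq ?_
            ring
        _ ≤ 2 * m * (t + R₀ + 1) ^ (-m) * (Cs * (t + R₀ + 1 - ‖x‖) ^ (-(1 - 1 / p))) := by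
            rw [← Finset.mul_sum]
            exact mul_le_mul_of_nonneg_left (hsum _ (by linarith) N) (by positivity)
        _ = _ := by ring)
  set J := sourceMass κ p u with hJ
  have hJ0 : 0 ≤ J t := sourceMass_nonneg ht0.le
  have hT0 : 0 < t + R₀ + 1 := by linarith
  set M : ℝ := ∫ s in (2 : ℝ)..t, (1 - s / t) * (s ^ (1 - q) * J s) / s with hM
  have hM0 : 0 ≤ M := by
    refine intervalIntegral.integral_nonneg ht fun s hs => ?_
    have hs0 : 0 ≤ s := by linarith [hs.1]
    have : s / t ≤ 1 := (div_le_one ht0).2 hs.2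
    have hJs : 0 ≤ J s := sourceMass_nonneg hs0
    exact div_nonneg (mul_nonneg (by linarith) (by positivity)) hs0
  have e1 : ∫ s in (2 : ℝ)..t, c * (s ^ (γ - 2 * m) * (1 - s / t)) * J s = c * M := by
    rw [hM, ← intervalIntegral.integral_const_mul]
    refine intervalIntegral.integral_congr fun s hs => ?_
    rw [uIcc_of_le ht] at hs
    have hs0 : 0 < s := by linarith [hs.1]
    have e2 : s ^ (1 - q) = s * s ^ (γ - 2 * m) := by
      rw [show 1 - q = 1 + (γ - 2 * m) by rw [hγ, hq]; ring, Real.rpow_add hs0, Real.rpow_one]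
    simp only [e2]
    field_simp
  have hexp : -((1 - 1 / p) * (p / (p - 1))) = -1 := by
    field_simp
  have e3 : ∫ y in (1 : ℝ)..t + R₀ + 1, y ^ (-((1 - 1 / p) * (p / (p - 1)))) =
      Real.log (t + R₀ + 1) := by
    rw [hexp]
    simp only [Real.rpow_neg_one]
    rw [integral_inv_of_pos one_pos hT0, div_one]
  have h1t := h1 t ht0.le
  rw [e3] at h1t
  rw [zero_mul, zero_add, e1, Real.mul_rpow hc0.le hM0] at hkey
  have hlogT : Real.log (t + R₀ + 1) ≤ Cl * Real.log t := by
    rw [add_assoc]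
    exact log_add_le ht (by linarith)
  have hlogT0 : 0 ≤ Real.log (t + R₀ + 1) := Real.log_nonneg (by linarith)
  have hlog0 : 0 ≤ Real.log t := Real.log_nonneg (by linarith)
  rw [div_mul_eq_mul_div, le_div_iff₀ (by positivity), mul_comm]
  calc c ^ p * M ^ p ≤ _ := hkey
    _ ≤ (1 + t) ^ κ * J t * (C₁ * ((t + R₀ + 1) ^ (m * (p - 2)) * (Cl * Real.log t) ^ (p - 1))) := by
      refine mul_le_mul_of_nonneg_left (h1t.trans ?_) (by positivity)
      gcongr
    _ = J t * (C₁ * Cl ^ (p - 1) * Real.log t ^ (p - 1)) *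
        ((1 + t) ^ κ * (t + R₀ + 1) ^ (m * (p - 2))) := by
      rw [Real.mul_rpow hCl0.le hlog0]
      ring
    _ ≤ J t * (C₁ * Cl ^ (p - 1) * Real.log t ^ (p - 1)) * (C₂ * t ^ (1 - q)) :=
      mul_le_mul_of_nonneg_left (h2 t (by linarith)) (by positivity)
    _ = _ := by ring

/-- No global solutions in the Strauss range; equality in `hκ` is the critical case, where the lower
bound of `exists_le_sourceMass` and the inequality of `exists_integral_inequality` just suffice. -/
theorem not_isWaveSolution_strauss (hn : 2 ≤ n) (hp : 1 < p) (hR : 0 ≤ R₀)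
    (hu : IsWaveSolution κ p u) (hc : SupportedInCone R₀ u) (hu0 : ∀ x, 0 ≤ u (0, x))
    (hu1 : ∀ x, 0 ≤ dt u (0, x)) (hmass : 0 < ∫ x, dt u (0, x))
    (hκ : κ + ((n : ℝ) - 1) / 2 * (p - 1) ≤ 1 + 1 / p) : False := by
  set m : ℝ := ((n : ℝ) - 1) / 2 with hm
  have hκ' : κ + m * (p - 2) ≤ 1 - (m - 1 / p) := by linarith
  obtain ⟨c, hc0, hci⟩ := exists_le_sourceMass hn hp hR hu hc hu0 hu1 hmass hm hκ'
  obtain ⟨C, hC⟩ := exists_integral_inequality hn hp hR hu hc hu0 hu1 hm hκ'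
  refine not_integral_inequality (i := fun s => s ^ (1 - (m - 1 / p)) * sourceMass κ p u s)
    (by norm_num : (1 : ℝ) ≤ 2) hp hc0 ?_ hci hC
  refine ContinuousOn.mul (ContinuousOn.rpow_const continuousOn_id fun s hs => Or.inl ?_)
    ((continuousOn_sourceMass hp hu.contDiffOn hc).mono (Ici_subset_Ici.2 (by norm_num)))
  exact (two_pos.trans_le hs).ne'

end Dyadic

/-! ### Reduction to the wave equation without damping -/

section Reduction

variable {n : ℕ} {V : ℝ × EuclideanSpace ℝ (Fin n) → ℝ}

theorem hasDerivWithinAt_dt (hV : ContDiffOn ℝ 2 V (futureHalf n)) {r : ℝ} (hr : 0 ≤ r)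
    (x : EuclideanSpace ℝ (Fin n)) :
    HasDerivWithinAt (fun r => V (r, x)) (dt V (r, x)) (Ici 0) r := by
  have h1 : HasFDerivWithinAt V (fderivWithin ℝ V (futureHalf n) (r, x)) (futureHalf n) (r, x) :=
    (hV.differentiableOn two_ne_zero (r, x) ⟨hr, mem_univ _⟩).hasFDerivWithinAt
  have h2 : HasDerivWithinAt (fun r : ℝ => (r, x)) ((1 : ℝ), (0 : EuclideanSpace ℝ (Fin n)))
      (Ici 0) r := ((hasDerivAt_id r).prodMk (hasDerivAt_const r x)).hasDerivWithinAt
  have h3 : MapsTo (fun r : ℝ => (r, x)) (Ici 0) (futureHalf n) := fun y hy => ⟨hy, mem_univ _⟩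
  exact h1.comp_hasDerivWithinAt r h2 h3

theorem fderiv_slice_eq_dx (hV : ContDiffOn ℝ 2 V (futureHalf n)) {r : ℝ} (hr : 0 ≤ r)
    (x : EuclideanSpace ℝ (Fin n)) (i : Fin n) :
    fderiv ℝ (fun y => V (r, y)) x (EuclideanSpace.single i 1) = dx V i (r, x) := by
  have h1 : HasFDerivWithinAt V (fderivWithin ℝ V (futureHalf n) (r, x)) (futureHalf n) (r, x) :=
    (hV.differentiableOn two_ne_zero (r, x) ⟨hr, mem_univ _⟩).hasFDerivWithinAt
  have h2 := h1.comp_hasFDerivAt x (hasFDerivAt_prodMk_right r x)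
    (Eventually.of_forall fun y => ⟨hr, mem_univ _⟩)
  have h3 : HasFDerivAt (fun y => V (r, y)) _ x := h2
  rw [h3.fderiv]
  simp [dx, spaceDir]

theorem iteratedDerivWithin_two_slice (hV : ContDiffOn ℝ 2 V (futureHalf n)) {s : ℝ} (hs : 0 < s)
    (x : EuclideanSpace ℝ (Fin n)) :
    iteratedDerivWithin 2 (fun r => V (r, x)) (Ici 0) s = fderiv ℝ (dt V) (s, x) (1, 0) := by
  have h1 : ∀ r ∈ Ici (0 : ℝ), derivWithin (fun r => V (r, x)) (Ici 0) r = dt V (r, x) :=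
    fun r hr => (hasDerivWithinAt_dt hV hr x).derivWithin (uniqueDiffOn_Ici 0 r hr)
  rw [iteratedDerivWithin_succ]
  have h2 : ∀ r ∈ Ici (0 : ℝ), iteratedDerivWithin 1 (fun r => V (r, x)) (Ici 0) r = dt V (r, x) := by
    intro r hr
    rw [iteratedDerivWithin_one, h1 r hr]
  rw [derivWithin_congr h2 (h2 s hs.le), derivWithin_of_mem_nhds (Ici_mem_nhds hs)]
  exact (hasDerivAt_slice_time (F := dt V)
    (contDiffOn_differentiableAt (contDiffOn_dt hV) hs)).deriv

theorem laplacian_slice (hV : ContDiffOn ℝ 2 V (futureHalf n)) {s : ℝ} (hs : 0 < s)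
    (x : EuclideanSpace ℝ (Fin n)) : Laplacian.laplacian (fun y => V (s, y)) x =
      ∑ i, fderiv ℝ (dx V i) (s, x) (spaceDir i) := by
  rw [InnerProductSpace.laplacian_eq_iteratedFDeriv_orthonormalBasis _
    (EuclideanSpace.basisFun (Fin n) ℝ)]
  refine Finset.sum_congr rfl fun i _ => ?_
  rw [iteratedFDeriv_two_apply]
  simp only [EuclideanSpace.basisFun_apply, Matrix.cons_val_zero, Matrix.cons_val_one]
  have hC : ContDiff ℝ 2 fun y => V (s, y) :=
    contDiff_slice (hV.mono Ioi_prod_subset_futureHalf) hs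
  have h1 : fderiv ℝ (fun y => fderiv ℝ (fun y => V (s, y)) y (EuclideanSpace.single i 1)) x
      (EuclideanSpace.single i 1) =
      fderiv ℝ (fderiv ℝ (fun y => V (s, y))) x (EuclideanSpace.single i 1)
        (EuclideanSpace.single i 1) := by
    rw [fderiv_clm_apply ((hC.fderiv_right (m := 1) (by norm_num)).differentiable one_ne_zero x)
      (differentiableAt_const _)]
    simp
  rw [← h1]
  have h2 : (fun y => fderiv ℝ (fun y => V (s, y)) y (EuclideanSpace.single i 1)) =
      fun y => dx V i (s, y) := funext fun y => fderiv_slice_eq_dx hV hs.le y i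
  rw [h2, fderiv_slice_space (contDiffOn_differentiableAt (contDiffOn_dx hV i) hs)]
  rfl

/-- The Liouville transform `(1 + t) ^ k V`. -/
noncomputable def liouville (k : ℝ) (V : ℝ × EuclideanSpace ℝ (Fin n) → ℝ)
    (z : ℝ × EuclideanSpace ℝ (Fin n)) : ℝ := (1 + z.1) ^ k * V z

theorem contDiffOn_liouville (k : ℝ) (hV : ContDiffOn ℝ 2 V (futureHalf n)) :
    ContDiffOn ℝ 2 (liouville k V) (futureHalf n) := by
  refine ContDiffOn.mul (ContDiffOn.rpow_const_of_ne (by fun_prop) fun z hz => ?_) hV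
  have : (0 : ℝ) ≤ z.1 := hz.1
  linarith

theorem hasDerivAt_one_add_rpow (k : ℝ) {r : ℝ} (hr : 0 ≤ r) :
    HasDerivAt (fun r : ℝ => (1 + r) ^ k) (k * (1 + r) ^ (k - 1)) r := by
  have h := ((hasDerivAt_id r).const_add 1).rpow_const (p := k)
    (Or.inl (by simp only [id]; linarith))
  simpa using h

theorem dt_liouville (k : ℝ) (hV : ContDiffOn ℝ 2 V (futureHalf n)) {r : ℝ} (hr : 0 ≤ r)
    (x : EuclideanSpace ℝ (Fin n)) : dt (liouville k V) (r, x) =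
      k * (1 + r) ^ (k - 1) * V (r, x) + (1 + r) ^ k * dt V (r, x) := by
  have h1 := hasDerivWithinAt_dt (contDiffOn_liouville k hV) hr x
  have h2 := (hasDerivAt_one_add_rpow k hr).hasDerivWithinAt.mul (hasDerivWithinAt_dt hV hr x)
  exact (uniqueDiffOn_Ici 0 r hr).eq_deriv _ h1 h2

theorem box_liouville (k : ℝ) (hV : ContDiffOn ℝ 2 V (futureHalf n)) {s : ℝ} (hs : 0 < s)
    (x : EuclideanSpace ℝ (Fin n)) : box (liouville k V) (s, x) =
      (1 + s) ^ k * (box V (s, x) + 2 * k / (1 + s) * dt V (s, x)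
        + k * (k - 1) / (1 + s) ^ 2 * V (s, x)) := by
  have hU := contDiffOn_liouville k hV
  have h1s : 0 < 1 + s := by linarith
  have hT : fderiv ℝ (dt (liouville k V)) (s, x) (1, 0) =
      k * (k - 1) * (1 + s) ^ (k - 1 - 1) * V (s, x) + 2 * (k * (1 + s) ^ (k - 1)) * dt V (s, x)
        + (1 + s) ^ k * fderiv ℝ (dt V) (s, x) (1, 0) := by
    have h1 := hasDerivAt_slice_time (F := dt (liouville k V)) (x := x)
      (contDiffOn_differentiableAt (contDiffOn_dt hU) (z := (s, x)) hs)
    have hVd : HasDerivAt (fun r => V (r, x)) (dt V (s, x)) s :=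
      (hasDerivWithinAt_dt hV hs.le x).hasDerivAt (Ici_mem_nhds hs)
    have hVdd := hasDerivAt_slice_time (F := dt V) (x := x)
      (contDiffOn_differentiableAt (contDiffOn_dt hV) (z := (s, x)) hs)
    have h2 := (((hasDerivAt_one_add_rpow (k - 1) hs.le).const_mul k).mul hVd).add
      ((hasDerivAt_one_add_rpow k hs.le).mul hVdd)
    have h3 : (fun r => dt (liouville k V) (r, x)) =ᶠ[𝓝 s]
        ((fun r : ℝ => k * (1 + r) ^ (k - 1)) * fun r => V (r, x)) +
          (fun r : ℝ => (1 + r) ^ k) * fun r => dt V (r, x) := by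
      filter_upwards [lt_mem_nhds hs] with r hr
      exact dt_liouville k hV hr.le x
    rw [h1.unique (h2.congr_of_eventuallyEq h3)]
    ring
  have hX : ∀ i, fderiv ℝ (dx (liouville k V) i) (s, x) (spaceDir i) =
      (1 + s) ^ k * fderiv ℝ (dx V i) (s, x) (spaceDir i) := by
    intro i
    have hd := contDiffOn_differentiableAt (contDiffOn_dx hV i) (z := (s, x)) hs
    have hdU := contDiffOn_differentiableAt (contDiffOn_dx hU i) (z := (s, x)) hs
    have h1 : ∀ y, dx (liouville k V) i (s, y) = (1 + s) ^ k * dx V i (s, y) := by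
      intro y
      rw [← fderiv_slice_eq_dx hU hs.le y i, ← fderiv_slice_eq_dx hV hs.le y i]
      have hC : Differentiable ℝ fun y => V (s, y) :=
        (contDiff_slice (hV.mono Ioi_prod_subset_futureHalf) hs).differentiable two_ne_zero
      have h2 : HasFDerivAt (fun y => liouville k V (s, y)) _ y :=
        (hC y).hasFDerivAt.const_mul ((1 + s) ^ k)
      rw [h2.fderiv]
      simp
    have e1 := fderiv_slice_space hdU (EuclideanSpace.single i 1)
    have e2 := fderiv_slice_space hd (EuclideanSpace.single i 1)
    have h3 : DifferentiableAt ℝ (fun y => dx V i (s, y)) x :=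
      (contDiff_slice (contDiffOn_dx hV i) hs).differentiable one_ne_zero x
    rw [spaceDir, ← e1, ← e2, funext h1, (h3.hasFDerivAt.const_mul ((1 + s) ^ k)).fderiv]
    simp
  simp only [box, hT, hX, ← Finset.mul_sum]
  rw [Real.rpow_sub_one h1s.ne', Real.rpow_sub_one h1s.ne']
  field_simp
  ring

end Reduction

theorem timeInterval_top : timeInterval ⊤ = Ici 0 := by
  ext t
  simp [timeInterval]

section Final

variable {n : ℕ} {μ p : ℝ} {v₀ v₁ : EuclideanSpace ℝ (Fin n) → ℝ}
  {v : ℝ → EuclideanSpace ℝ (Fin n) → ℝ}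

/-- With `m = μ (μ - 2)` the substitution `u = (1 + t) ^ (μ / 2) v` removes the damping and the mass
term at the same time. -/
theorem IsClassicalSolution.isWaveSolution
    (hv : IsClassicalSolution n μ ((μ - 2) * μ) p v₀ v₁ ⊤ v) :
    IsWaveSolution (μ / 2 * (p - 1)) p (liouville (μ / 2) fun z => v z.1 z.2) := by
  have hV : ContDiffOn ℝ 2 (fun z : ℝ × EuclideanSpace ℝ (Fin n) => v z.1 z.2) (futureHalf n) := by
    have := hv.contDiffOn
    rwa [timeInterval_top] at this
  refine ⟨contDiffOn_liouville _ hV, fun z hz => ?_⟩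
  obtain ⟨s, x⟩ := z
  have hs : 0 < s := hz
  have h1s : 0 < 1 + s := by linarith
  have heq := hv.equation s (by rw [timeInterval_top]; exact hs.le) x
  rw [timeInterval_top, iteratedDerivWithin_two_slice hV hs x,
    (hasDerivWithinAt_dt hV hs.le x).derivWithin (uniqueDiffOn_Ici 0 s hs.le),
    show v s = fun y => v s y from rfl, laplacian_slice hV hs x] at heq
  rw [box_liouville _ hV hs x]
  have h1 : box (fun z : ℝ × EuclideanSpace ℝ (Fin n) => v z.1 z.2) (s, x)
      + 2 * (μ / 2) / (1 + s) * dt (fun z => v z.1 z.2) (s, x)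
      + μ / 2 * (μ / 2 - 1) / (1 + s) ^ 2 * v s x = |v s x| ^ p := by
    rw [← heq, box]
    field_simp
    ring
  simp only [h1, liouville]
  rw [abs_mul, abs_of_pos (Real.rpow_pos_of_pos h1s _), Real.mul_rpow (by positivity) (abs_nonneg _),
    ← mul_assoc, ← Real.rpow_mul h1s.le, ← Real.rpow_add h1s]
  congr 2
  ring

theorem le_pFujita_iff {d : ℝ} (hd : 0 < d) : p ≤ pFujita d ↔ d * (p - 1) ≤ 2 := by
  rw [pFujita, ← sub_le_iff_le_add', le_div_iff₀ hd, mul_comm]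

theorem of_le_pStrauss {d : ℝ} (hd : 1 < d) (hp : 0 < p) (h : p ≤ pStrauss d) :
    (d - 1) * p ^ 2 - (d + 1) * p - 2 ≤ 0 := by
  obtain ⟨hP, hPeq⟩ := (eq_pStrauss_iff hd (pStrauss d)).1 rfl
  set P := pStrauss d with hPdef
  -- `(d - 1) p - (d + 1) - 2 / p` is increasing in `p`
  have h1 : ((d - 1) * p ^ 2 - (d + 1) * p - 2) * P =
      p * ((d - 1) * P ^ 2 - (d + 1) * P - 2) - (P - p) * ((d - 1) * p * P + 2) := by ring
  have h2 : 0 ≤ (P - p) * ((d - 1) * p * P + 2) := by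
    have h3 : 0 ≤ P - p := by linarith
    have h4 : 0 < d - 1 := by linarith
    positivity
  rw [hPeq, mul_zero, zero_sub] at h1
  by_contra hcon
  have := mul_pos (not_le.1 hcon) hP
  linarith

end Final

theorem theorem6p1 (n : ℕ) (hn : 1 ≤ n) (μ : ℝ) (hμ : 0 < μ) (p : ℝ) (hp : 1 < p)
    (hp_le : p ≤ max (pFujita ((n : ℝ) - 1 + μ / 2)) (pStrauss ((n : ℝ) + μ)))
    (v₀ v₁ : EuclideanSpace ℝ (Fin n) → ℝ)
    (hv₀ : ContDiff ℝ 2 v₀) (hv₀_supp : HasCompactSupport v₀)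
    (hv₁ : ContDiff ℝ 1 v₁) (hv₁_supp : HasCompactSupport v₁)
    (hv₀_nonneg : ∀ x, 0 ≤ v₀ x) (hv₁_nonneg : ∀ x, 0 ≤ v₁ x)
    (hdata : ¬ ((∀ x, v₀ x = 0) ∧ (∀ x, v₁ x = 0)))
    (T : EReal) (hT : 0 < T) (v : ℝ → EuclideanSpace ℝ (Fin n) → ℝ)
    (hv : IsClassicalSolution n μ ((μ - 2) * μ) p v₀ v₁ T v) :
    T < ⊤ := by
  rw [lt_top_iff_ne_top]
  rintro rfl
  have hn' : (1 : ℝ) ≤ n := by exact_mod_cast hn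
  have hV : ContDiffOn ℝ 2 (fun z : ℝ × EuclideanSpace ℝ (Fin n) => v z.1 z.2) (futureHalf n) := by
    have := hv.contDiffOn
    rwa [timeInterval_top] at this
  set u := liouville (μ / 2) fun z : ℝ × EuclideanSpace ℝ (Fin n) => v z.1 z.2 with hu_def
  have hu : IsWaveSolution (μ / 2 * (p - 1)) p u := hv.isWaveSolution
  -- the Cauchy data of `u`
  have hu0 : ∀ x, u (0, x) = v₀ x := fun x => by simp [hu_def, liouville, hv.initial_value]
  have hu1 : ∀ x, dt u (0, x) = v₁ x + μ / 2 * v₀ x := by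
    intro x
    have h1 := hv.initial_velocity x
    rw [timeInterval_top, (hasDerivWithinAt_dt hV le_rfl x).derivWithin
      (uniqueDiffOn_Ici 0 0 self_mem_Ici)] at h1
    rw [hu_def, dt_liouville _ hV le_rfl, h1]
    simp [hv.initial_value]
    ring
  have hu1n : ∀ x, 0 ≤ dt u (0, x) := fun x => by
    rw [hu1]
    have := hv₀_nonneg x
    have := hv₁_nonneg x
    positivity
  obtain ⟨R₀, hR0, hR⟩ : ∃ R₀ : ℝ, 0 ≤ R₀ ∧ ∀ x, R₀ < ‖x‖ → x ∉ tsupport v₀ ∧ x ∉ tsupport v₁ := by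
    obtain ⟨R, hR⟩ := (hv₀_supp.isCompact.union hv₁_supp.isCompact).isBounded.subset_closedBall 0
    refine ⟨max R 0, le_max_right _ _, fun x hx => ?_⟩
    have hxR : x ∉ Metric.closedBall 0 R := by
      simpa using (le_max_left _ _).trans_lt hx
    exact ⟨fun h => hxR (hR (Or.inl h)), fun h => hxR (hR (Or.inr h))⟩
  have hz0 : ∀ x, R₀ < ‖x‖ → u (0, x) = 0 := fun x hx => by
    rw [hu0, image_eq_zero_of_notMem_tsupport (hR x hx).1]
  have hz1 : ∀ x, R₀ < ‖x‖ → dt u (0, x) = 0 := fun x hx => by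
    rw [hu1, image_eq_zero_of_notMem_tsupport (hR x hx).1,
      image_eq_zero_of_notMem_tsupport (hR x hx).2]
    simp
  have hz2 : ∀ x, R₀ < ‖x‖ → ∀ i, dx u i (0, x) = 0 := fun x hx i => by
    rw [← fderiv_slice_eq_dx hu.contDiffOn le_rfl x i, funext hu0,
      (notMem_tsupport_iff_eventuallyEq.1 (hR x hx).1).fderiv_eq]
    simp
  have hκ : 0 ≤ μ / 2 * (p - 1) := mul_nonneg (by positivity) (by linarith)
  have hsupp : ∀ t, 0 ≤ t → ∀ x, t + R₀ < ‖x‖ → u (t, x) = 0 := fun t ht x hx =>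
    hu.eq_zero_of_lt_norm hκ hp hz0 hz1 hz2 ht hx
  have hc : SupportedInCone R₀ u := by
    refine ⟨hsupp, fun t ht x hx => ?_⟩
    rcases ht.eq_or_lt with rfl | ht
    · exact hz1 x (by linarith)
    · exact dt_eq_zero_of_eq_zero hsupp ht hx
  have hmass : 0 < ∫ x, dt u (0, x) := by
    have hne : ∃ x, dt u (0, x) ≠ 0 := by
      by_contra! hcon
      refine hdata ⟨fun x => ?_, fun x => ?_⟩ <;>
      · have h1 := hcon x
        rw [hu1] at h1
        nlinarith [hv₀_nonneg x, hv₁_nonneg x, mul_nonneg hμ.le (hv₀_nonneg x)]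
    obtain ⟨x, hx⟩ := hne
    refine (continuous_slice_of_nonneg (continuousOn_dt hu.contDiffOn) le_rfl
      ).integral_pos_of_hasCompactSupport_nonneg_nonzero ?_ hu1n hx
    exact hasCompactSupport_of_forall_lt_dist (c := 0) fun x hx => hz1 x (by simpa using hx)
  have hu0n : ∀ x, 0 ≤ u (0, x) := fun x => (hu0 x).symm ▸ hv₀_nonneg x
  have hFuj : ¬ ((n : ℝ) - 1 + μ / 2) * (p - 1) ≤ 2 := fun h =>
    not_isWaveSolution_fujita hn hp hR0 hu hc hu0n hu1n hmass (by linarith)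
  rcases le_max_iff.1 hp_le with h | h
  · exact hFuj ((le_pFujita_iff (by linarith)).1 h)
  · have h1 := of_le_pStrauss (by linarith) (by linarith) h
    -- outside the Fujita range the Strauss condition forces `(n - 1) p > 2`, hence `n ≥ 2`
    have hn2 : 2 ≤ n := by
      by_contra hlt
      have : n = 1 := by omega
      subst this
      push_cast at h1 hFuj
      nlinarith
    refine not_isWaveSolution_strauss hn2 hp hR0 hu hc hu0n hu1n hmass ?_
    have h2 : (μ / 2 * (p - 1) + ((n : ℝ) - 1) / 2 * (p - 1)) * p ≤ p + 1 := by nlinarith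
    have h3 : 1 + 1 / p = (p + 1) / p := by
      field_simp
    rw [h3, le_div_iff₀ (by linarith)]
    exact h2
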